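/- **Lemma (module curvature of the principal module of the loop-space lifting gerbe).** Let $G$ be a finite-dimensional real Lie group (for instance a compact simple one) with Lie algebra $\mathfrak g$ and an $\mathrm{Ad}$-invariant symmetric bilinear form $\langle\,,\rangle$ on $\mathfrak g$, and let $\mathbb T=\mathbb R/\mathbb Z$. On $L\mathfrak g=C^\infty(\mathbb T,\mathfrak g)$ put $\langle\!\langle\xi,\eta\rangle\!\rangle=\int_{\mathbb T}\langle\xi(\theta),\eta(\theta)\rangle\,d\theta$. Let $\check{\mathsf G}=\mathbb T\ltimes LG$, where $\mathbb T$ acts by $(\rho_\phi\gamma)(\theta)=\gamma(\theta+\phi)$; its Lie algebra is $\check{\mathfrak g}=\mathbb R\oplus L\mathfrak g$ with $[(x_1,\xi_1),(x_2,\xi_2)]=(0,[\xi_1,\xi_2]+x_1\xi_2'-x_2\xi_1')$. For $k\in\mathbb Z$ let $\tilde{\mathfrak g}_k=\mathbb R\oplus L\mathfrak g\oplus\mathbb R$ be the affine Lie algebra with $$[(x_1,\xi_1,y_1),(x_2,\xi_2,y_2)]=(0,[\xi_1,\xi_2]+x_1\xi_2'-x_2\xi_1',k\langle\!\langle\xi_1,\xi_2'\rangle\!\rangle),$$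 with invariant pairing $\langle X_1,X_2\rangle_k=k\langle\!\langle\xi_1,\xi_2\rangle\!\rangle-x_1y_2-x_2y_1$, with the action $\mathrm{Ad}$ of $\check{\mathsf G}$ in which $\phi\in\mathbb T$ acts by $\rho_\phi$ on $\xi$ and $\gamma\in LG$ by $$\mathrm{Ad}_\gamma(x,\xi,y)=\bigl(x,\ \mathrm{Ad}_\gamma\xi-x\gamma'\gamma^{-1},\ y-k\langle\!\langle\gamma^{-1}\gamma',\xi\rangle\!\rangle+\tfrac k2x\langle\!\langle\gamma^{-1}\gamma',\gamma^{-1}\gamma'\rangle\!\rangle\bigr),$$ and with the linear splitting $\sigma:\check{\mathfrak g}\to\tilde{\mathfrak g}_k$, $\sigma(x,\xi)=(x,\xi,0)$, and cocycle $\omega_\sigma(X,Y)=[\sigma X,\sigma Y]-\sigma[X,Y]$. Let $\mathbb T\to\tilde{\mathsf G}_k\xrightarrow{\,q\,}\check{\mathsf G}$ be a smooth central extension with Lie algebra $\tilde{\mathfrak g}_k$, with left Maurer–Cartan form $\tilde\mu$. Let $Q\to B$ be a principal $\check{\mathsf G}$-bundle with a connection $L=(\lambda,\Lambda)$ of curvature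 $F_L=(d\lambda,F_\Lambda)$, and with a Higgs field $V=(1,-\Phi)$, i.e. a smooth map $\Phi:Q\to L\mathfrak g$ such that $V(qg)=\mathrm{Ad}_{g^{-1}}V(q)$. Put $\tilde V=(1,-\Phi,\tfrac k2\langle\!\langle\Phi,\Phi\rangle\!\rangle)$, and let $s(X)=-\langle X,\tilde V\rangle_k$ be the induced bundle splitting, which is the identity on the centre. The lifting bundle gerbe $\mathbb L_k(L,V)$ has total space $J=Q\times\tilde{\mathsf G}_k$ with $\rho(p,h)=(p,p\,q(h))$, and curving $f=-(\tfrac12\omega_\sigma(L,L)+s(\sigma(F_L)))$; its principal module has the connection $\phi=\tilde\mu+\mathrm{Ad}_{q(h)^{-1}}\sigma(\pi_1^*L)$ on $J$, with curvature $F_\phi=d\phi+\tfrac12[\phi\wedge\phi]$. Then there is exactly one $\tilde{\mathfrak g}_k$-valued 2-form $\mathcal F_\phi$ on $Q$ (the module curvature of the principal module) with $$\rho^*\pi_2^*\mathcal F_\phi=F_\phi+\rho^*\pi_1^*f,$$ and it is $$\mathcal F_\phi=(1-s)\,\sigma(F_L)=\Bigl(d\lambda,\ F_\Lambda,\ -k\langle\!\langle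 F_\Lambda,\Phi\rangle\!\rangle-\tfrac k2\,d\lambda\,\langle\!\langle\Phi,\Phi\rangle\!\rangle\Bigr).$$ -/

import Mathlib

open scoped Manifold ContDiff Topology
open Diffeology

noncomputable section

namespace LoopLift

/-- Parameter spaces of plots. -/
abbrev Euc (n : ℕ) : Type := EuclideanSpace ℝ (Fin n)

/-! ### The Lie group `G` and its Lie algebra

`G` is a real Lie group modelled on `E`; its Lie algebra, the tangent space at `1`, is `E`. -/

section LieGroup

variable {E : Type*} [NormedAddCommGroup E] [NormedSpace ℝ E]
variable (G : Type*) [TopologicalSpace G] [ChartedSpace E G] [Group G]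

/-- The Lie bracket of the Lie algebra of `G`. -/
def gBracket (x y : E) : E :=
  Bracket.bracket (L := GroupLieAlgebra 𝓘(ℝ, E) G) (M := GroupLieAlgebra 𝓘(ℝ, E) G) x y

variable {G}

/-- The adjoint action of `G` on its Lie algebra. -/
def gAd (g : G) (x : E) : E := mfderiv 𝓘(ℝ, E) 𝓘(ℝ, E) (fun a : G => g * a * g⁻¹) 1 x

/-- The left logarithmic derivative `c⁻¹ dc`, at `w` in the direction `v`. -/
def logDeriv {W : Type*} [NormedAddCommGroup W] [NormedSpace ℝ W] (c : W → G) (w v : W) : E :=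
  mfderiv 𝓘(ℝ, W) 𝓘(ℝ, E) (fun w' => (c w)⁻¹ * c w') w v

end LieGroup

/-! ### The circle, loops and loop rotation -/

/-- The derivative of a map `c` to the circle `ℝ/ℤ`, at `u` in the direction `v`: the derivative
of the real-valued local lift of `c - c u` through `0`, which is
`sin (2 π (c - c u)) / (2 π)` to first order. -/
def angleDeriv {W : Type*} [NormedAddCommGroup W] [NormedSpace ℝ W]
    (c : W → UnitAddCircle) (u v : W) : ℝ :=
  fderiv ℝ (fun w => ((AddCircle.toCircle (c w - c u) : Circle) : ℂ).im / (2 * Real.pi)) u v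

/-- The smooth loop group `LG`, with pointwise multiplication. -/
def LoopGroup (E : Type*) [NormedAddCommGroup E] [NormedSpace ℝ E] (G : Type*)
    [TopologicalSpace G] [ChartedSpace E G] [Group G] [LieGroup 𝓘(ℝ, E) ∞ G] :
    Subgroup (UnitAddCircle → G) where
  carrier := {γ | ContMDiff 𝓘(ℝ, ℝ) 𝓘(ℝ, E) ∞ (fun t : ℝ => γ (t : UnitAddCircle))}
  mul_mem' ha hb := ha.mul hb
  one_mem' := contMDiff_const
  inv_mem' ha := ha.inv

section Loops

variable {E : Type*} [NormedAddCommGroup E] [NormedSpace ℝ E] {G : Type*}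
    [TopologicalSpace G] [ChartedSpace E G] [Group G] [LieGroup 𝓘(ℝ, E) ∞ G]

/-- Rotation of a loop: `(ρ_φ γ)(θ) = γ (θ + φ)`. -/
def rotate (φ : UnitAddCircle) (γ : LoopGroup E G) : LoopGroup E G :=
  ⟨fun θ => γ.1 (θ + φ), by
    obtain ⟨s, rfl⟩ := QuotientAddGroup.mk_surjective φ
    have h : ContMDiff 𝓘(ℝ, ℝ) 𝓘(ℝ, E) ∞ (fun t : ℝ => γ.1 (t : UnitAddCircle)) := γ.2
    have h2 : ContMDiff 𝓘(ℝ, ℝ) 𝓘(ℝ, ℝ) ∞ (fun t : ℝ => t + s) :=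
      (contDiff_id.add contDiff_const).contMDiff
    exact h.comp h2⟩

variable (E G)

/-- The action of the circle on the loop group by rotation. -/
def rotation : Multiplicative UnitAddCircle →* MulAut (LoopGroup E G) where
  toFun φ :=
    { toFun := rotate φ.toAdd
      invFun := rotate (-φ.toAdd)
      left_inv := fun γ => by ext θ; simp [rotate]
      right_inv := fun γ => by ext θ; simp [rotate]
      map_mul' := fun γ δ => by ext θ; simp [rotate] }
  map_one' := by ext γ θ; simp [rotate]
  map_mul' φ ψ := by ext γ θ; simp [rotate, add_assoc]

/-- The group `𝕋 ⋉ LG`: an element `g` has the loop `g.left` and the angle `g.right`, and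
`(γ₁, φ₁) * (γ₂, φ₂) = (γ₁ * ρ_{φ₁} γ₂, φ₁ + φ₂)`. -/
abbrev LoopRot : Type _ := LoopGroup E G ⋊[rotation E G] Multiplicative UnitAddCircle

variable {E G}

/-- The angle of an element of `𝕋 ⋉ LG`. -/
def LoopRot.angle (g : LoopRot E G) : UnitAddCircle := g.right.toAdd

/-- The loop of an element of `𝕋 ⋉ LG`. -/
def LoopRot.loop (g : LoopRot E G) : UnitAddCircle → G := g.left.1

/-- Smooth families of elements of `𝕋 ⋉ LG`: the loop depends smoothly on the parameter and the
loop variable jointly, and the angle is smooth, that is, has a smooth real lift (which exists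
globally as the parameter space is simply connected). -/
def SmoothLoopRot {n : ℕ} (g : Euc n → LoopRot E G) : Prop :=
  (∃ c : Euc n → ℝ, ContDiff ℝ ∞ c ∧ ∀ u, (g u).angle = (c u : UnitAddCircle)) ∧
  ContMDiff 𝓘(ℝ, Euc n × ℝ) 𝓘(ℝ, E) ∞
    (fun z : Euc n × ℝ => (g z.1).loop (z.2 : UnitAddCircle))

end Loops

/-! ### The Lie algebras

The elements of the loop algebra are the smooth functions on the circle with values in `E`; the
operations are written down for all functions. -/

/-- The Lie algebra `ℝ ⊕ L𝔤` of `𝕋 ⋉ LG`. -/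
abbrev RotAlg (E : Type*) : Type _ := ℝ × (UnitAddCircle → E)

/-- The affine Lie algebra `ℝ ⊕ L𝔤 ⊕ ℝ`, with triples `(x, ξ, y)`. -/
abbrev AffAlg (E : Type*) : Type _ := ℝ × (UnitAddCircle → E) × ℝ

section Algebra

variable {E : Type*} [NormedAddCommGroup E] [NormedSpace ℝ E]

/-- The derivative of a loop in the loop variable. -/
def loopDeriv (ξ : UnitAddCircle → E) (θ : UnitAddCircle) : E :=
  deriv (fun t : ℝ => ξ (θ + (t : UnitAddCircle))) 0

/-- The pairing `⟪ξ, η⟫ = ∫ ⟨ξ(θ), η(θ)⟩ dθ` of loops. -/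
def loopPair (ip : LinearMap.BilinForm ℝ E) (ξ η : UnitAddCircle → E) : ℝ :=
  ∫ θ : UnitAddCircle, ip (ξ θ) (η θ)

/-- The projection of the affine algebra to the quotient by its centre. -/
def proj (X : AffAlg E) : RotAlg E := (X.1, X.2.1)

/-- The standard linear splitting `σ (x, ξ) = (x, ξ, 0)`. -/
def sigma (X : RotAlg E) : AffAlg E := (X.1, X.2, 0)

/-- The inclusion of the centre. -/
def centre (y : ℝ) : AffAlg E := (0, 0, y)

/-- The invariant pairing on the level `k` affine algebra. -/
def affPair (ip : LinearMap.BilinForm ℝ E) (k : ℤ) (X Y : AffAlg E) : ℝ :=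
  k * loopPair ip X.2.1 Y.2.1 - X.1 * Y.2.2 - Y.1 * X.2.2

variable (G : Type*) [TopologicalSpace G] [ChartedSpace E G] [Group G]

/-- The bracket of `ℝ ⊕ L𝔤`. -/
def rotBracket (X Y : RotAlg E) : RotAlg E :=
  (0, fun θ => gBracket G (X.2 θ) (Y.2 θ) + X.1 • loopDeriv Y.2 θ - Y.1 • loopDeriv X.2 θ)

/-- The bracket of the level `k` affine algebra. -/
def affBracket (ip : LinearMap.BilinForm ℝ E) (k : ℤ) (X Y : AffAlg E) : AffAlg E :=
  (0, fun θ => gBracket G (X.2.1 θ) (Y.2.1 θ) + X.1 • loopDeriv Y.2.1 θ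
      - Y.1 • loopDeriv X.2.1 θ,
    k * loopPair ip X.2.1 (loopDeriv Y.2.1))

/-- The Lie algebra cocycle `ω_σ(X, Y) = [σ X, σ Y] - σ [X, Y]`, an element of the centre. -/
def omegaSigma (ip : LinearMap.BilinForm ℝ E) (k : ℤ) (X Y : RotAlg E) : AffAlg E :=
  affBracket G ip k (sigma X) (sigma Y) - sigma (rotBracket G X Y)

variable {G} [LieGroup 𝓘(ℝ, E) ∞ G]

/-- The left logarithmic derivative `γ⁻¹ γ'` of the loop of `g` in the loop variable. -/
def loopLog (g : LoopRot E G) (θ : UnitAddCircle) : E :=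
  logDeriv (fun t : ℝ => g.loop (θ + (t : UnitAddCircle))) 0 1

/-- The adjoint action of `𝕋 ⋉ LG` on its Lie algebra: for `g = (γ, φ)` it is the rotation by `φ`
followed by `(x, ξ) ↦ (x, Ad_γ ξ - x γ' γ⁻¹)`, where `γ' γ⁻¹ = Ad_γ (γ⁻¹ γ')`. -/
def rotAd (g : LoopRot E G) (X : RotAlg E) : RotAlg E :=
  (X.1, fun θ => gAd (g.loop θ) (X.2 (θ + g.angle)) - X.1 • gAd (g.loop θ) (loopLog g θ))

/-- The adjoint action of `𝕋 ⋉ LG` on the level `k` affine algebra: for `g = (γ, φ)` it is the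
rotation by `φ` followed by
`(x, ξ, y) ↦ (x, Ad_γ ξ - x γ' γ⁻¹, y - k ⟪γ⁻¹ γ', ξ⟫ + (k / 2) x ⟪γ⁻¹ γ', γ⁻¹ γ'⟫)`. -/
def affAd (ip : LinearMap.BilinForm ℝ E) (k : ℤ) (g : LoopRot E G) (X : AffAlg E) : AffAlg E :=
  ((rotAd g (proj X)).1, (rotAd g (proj X)).2,
    X.2.2 - k * loopPair ip (loopLog g) (fun θ => X.2.1 (θ + g.angle))
      + (k / 2 : ℝ) * X.1 * loopPair ip (loopLog g) (loopLog g))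

/-- The left Maurer-Cartan form of `𝕋 ⋉ LG` on a family `g = (γ, φ)`:
`g⁻¹ dg = (dφ, ρ_{-φ} (γ⁻¹ dγ))`. -/
def maurerCartan {n : ℕ} (g : Euc n → LoopRot E G) (u v : Euc n) : RotAlg E :=
  (angleDeriv (fun w => (g w).angle) u v,
    fun θ => logDeriv (fun w => (g w).loop (θ - (g u).angle)) u v)

end Algebra

/-! ### Smooth families and differential forms

A differential form on a diffeological space is a family of forms on its plots which is compatible
with smooth changes of parameters. -/

section Forms

/-- Smooth families of loops in `E`. -/
def SmoothLoop {E : Type*} [NormedAddCommGroup E] [NormedSpace ℝ E] {n : ℕ}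
    (ξ : Euc n → UnitAddCircle → E) : Prop :=
  ContDiff ℝ ∞ (fun z : Euc n × ℝ => ξ z.1 (z.2 : UnitAddCircle))

/-- Smooth families of real numbers. -/
def SmoothReal : ∀ ⦃n : ℕ⦄, (Euc n → ℝ) → Prop := fun _ f => ContDiff ℝ ∞ f

/-- Smooth families of elements of `ℝ ⊕ L𝔤`. -/
def SmoothRot (E : Type*) [NormedAddCommGroup E] [NormedSpace ℝ E] :
    ∀ ⦃n : ℕ⦄, (Euc n → RotAlg E) → Prop :=
  fun _ f => ContDiff ℝ ∞ (fun u => (f u).1) ∧ SmoothLoop (fun u => (f u).2)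

/-- Smooth families of elements of the affine algebra. -/
def SmoothAff (E : Type*) [NormedAddCommGroup E] [NormedSpace ℝ E] :
    ∀ ⦃n : ℕ⦄, (Euc n → AffAlg E) → Prop :=
  fun _ f => ContDiff ℝ ∞ (fun u => (f u).1) ∧ SmoothLoop (fun u => (f u).2.1) ∧
    ContDiff ℝ ∞ (fun u => (f u).2.2)

/-- Differential 1-forms on `X` with values in `V`, where `S` singles out the smooth families. -/
@[ext]
structure OneForm (X : Type*) [DiffeologicalSpace X] (V : Type*) [AddCommGroup V] [Module ℝ V]
    (S : ∀ ⦃n : ℕ⦄, (Euc n → V) → Prop) where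
  val : ∀ {n : ℕ} (p : Euc n → X), IsPlot p → Euc n → Euc n →ₗ[ℝ] V
  smooth : ∀ {n : ℕ} (p : Euc n → X) (hp : IsPlot p) (v : Euc n), S (fun u => val p hp u v)
  natural : ∀ {m n : ℕ} (p : Euc n → X) (hp : IsPlot p) (f : Euc m → Euc n)
    (hf : ContDiff ℝ ∞ f) (u v : Euc m),
    val (p ∘ f) (isPlot_reparam hp hf) u v = val p hp (f u) (fderiv ℝ f u v)

/-- Differential 2-forms on `X` with values in `V`, where `S` singles out the smooth families. -/
@[ext]
structure TwoForm (X : Type*) [DiffeologicalSpace X] (V : Type*) [AddCommGroup V] [Module ℝ V]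
    (S : ∀ ⦃n : ℕ⦄, (Euc n → V) → Prop) where
  val : ∀ {n : ℕ} (p : Euc n → X), IsPlot p → Euc n → Euc n →ₗ[ℝ] Euc n →ₗ[ℝ] V
  alternating : ∀ {n : ℕ} (p : Euc n → X) (hp : IsPlot p) (u v : Euc n), val p hp u v v = 0
  smooth : ∀ {n : ℕ} (p : Euc n → X) (hp : IsPlot p) (v w : Euc n), S (fun u => val p hp u v w)
  natural : ∀ {m n : ℕ} (p : Euc n → X) (hp : IsPlot p) (f : Euc m → Euc n)
    (hf : ContDiff ℝ ∞ f) (u v w : Euc m),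
    val (p ∘ f) (isPlot_reparam hp hf) u v w
      = val p hp (f u) (fderiv ℝ f u v) (fderiv ℝ f u w)

/-- The exterior derivative of a 1-form `α` on `ℝⁿ`, evaluated on constant vector fields:
`dα(v, w) = ∂_v (α w) - ∂_w (α v)`. -/
def extD {F : Type*} [NormedAddCommGroup F] [NormedSpace ℝ F] {n : ℕ}
    (α : Euc n → Euc n → F) (u v w : Euc n) : F :=
  fderiv ℝ (fun u' => α u' w) u v - fderiv ℝ (fun u' => α u' v) u w

/-- The exterior derivative of a 1-form on `ℝⁿ` with values in functions on the circle. -/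
def extDLoop {E : Type*} [NormedAddCommGroup E] [NormedSpace ℝ E] {n : ℕ}
    (α : Euc n → Euc n → UnitAddCircle → E) (u v w : Euc n) : UnitAddCircle → E :=
  fun θ => extD (fun u' v' => α u' v' θ) u v w

variable {E : Type*} [NormedAddCommGroup E] [NormedSpace ℝ E]
variable (G : Type*) [TopologicalSpace G] [ChartedSpace E G] [Group G]

/-- The curvature `dα + ½ [α ∧ α]` of a 1-form on `ℝⁿ` with values in `ℝ ⊕ L𝔤`; here
`½ [α ∧ α](v, w) = [α v, α w]`. -/
def rotCurv {n : ℕ} (α : Euc n → Euc n → RotAlg E) (u v w : Euc n) : RotAlg E :=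
  (extD (fun u' v' => (α u' v').1) u v w, extDLoop (fun u' v' => (α u' v').2) u v w)
    + rotBracket G (α u v) (α u w)

/-- The curvature `dα + ½ [α ∧ α]` of a 1-form on `ℝⁿ` with values in the affine algebra. -/
def affCurv (ip : LinearMap.BilinForm ℝ E) (k : ℤ) {n : ℕ} (α : Euc n → Euc n → AffAlg E)
    (u v w : Euc n) : AffAlg E :=
  (extD (fun u' v' => (α u' v').1) u v w, extDLoop (fun u' v' => (α u' v').2.1) u v w,
    extD (fun u' v' => (α u' v').2.2) u v w) + affBracket G ip k (α u v) (α u w)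

end Forms

/-! ### Bundles, connections, Higgs fields and the central extension -/

section Geometry

variable {E : Type*} [NormedAddCommGroup E] [NormedSpace ℝ E] {G : Type*}
    [TopologicalSpace G] [ChartedSpace E G] [Group G] [LieGroup 𝓘(ℝ, E) ∞ G]

/-- The right action of `𝕋 ⋉ LG`. -/
abbrev ract {Q : Type*} [MulAction (LoopRot E G)ᵐᵒᵖ Q] (q : Q) (g : LoopRot E G) : Q :=
  MulOpposite.op g • q

variable (E G) in
/-- `π : Q → B` is a smooth principal bundle with structure group `𝕋 ⋉ LG`. -/
structure IsPrincipalBundle {Q B : Type*} [DiffeologicalSpace Q] [DiffeologicalSpace B]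
    [MulAction (LoopRot E G)ᵐᵒᵖ Q] (π : Q → B) : Prop where
  smooth_proj : DSmooth π
  smooth_act : ∀ {n : ℕ} (p : Euc n → Q) (g : Euc n → LoopRot E G), IsPlot p →
    SmoothLoopRot g → IsPlot (fun u => ract (p u) (g u))
  fibres : ∀ q q' : Q, π q = π q' ↔ ∃ g : LoopRot E G, ract q g = q'
  free : ∀ (q : Q) (g : LoopRot E G), ract q g = q → g = 1
  smooth_div : ∀ {n : ℕ} (p : Euc n → Q) (g : Euc n → LoopRot E G), IsPlot p →
    IsPlot (fun u => ract (p u) (g u)) → SmoothLoopRot g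
  local_lift : ∀ {n : ℕ} (b : Euc n → B), IsPlot b → ∀ u, ∃ p : Euc n → Q, IsPlot p ∧
    ∀ᶠ u' in 𝓝 u, π (p u') = b u'

variable (E G) in
/-- A connection `L = (λ, Λ)` on a principal `𝕋 ⋉ LG`-bundle. -/
structure Connection (Q : Type*) [DiffeologicalSpace Q] [MulAction (LoopRot E G)ᵐᵒᵖ Q] where
  form : OneForm Q (RotAlg E) (SmoothRot E)
  equivariant : ∀ {n : ℕ} (p : Euc n → Q) (hp : IsPlot p) (g : LoopRot E G)
    (hpg : IsPlot (fun u => ract (p u) g)) (u v : Euc n),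
    form.val (fun u' => ract (p u') g) hpg u v = rotAd g⁻¹ (form.val p hp u v)
  vertical : ∀ {n : ℕ} (q : Q) (g : Euc n → LoopRot E G) (_ : SmoothLoopRot g)
    (hqg : IsPlot (fun u => ract q (g u))) (u v : Euc n),
    form.val (fun u' => ract q (g u')) hqg u v = maurerCartan g u v

variable (E G) in
/-- A Higgs field `V = (1, -Φ)`, a section of the bundle associated with the adjoint action. -/
structure HiggsField (Q : Type*) [DiffeologicalSpace Q] [MulAction (LoopRot E G)ᵐᵒᵖ Q] where
  Φ : Q → UnitAddCircle → E
  smooth : ∀ {n : ℕ} (p : Euc n → Q), IsPlot p → SmoothLoop (fun u => Φ (p u))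
  equivariant : ∀ (q : Q) (g : LoopRot E G),
    ((1, -Φ (ract q g)) : RotAlg E) = rotAd g⁻¹ (1, -Φ q)

variable (E G) in
/-- A level `k` central extension `1 → 𝕋 → K → 𝕋 ⋉ LG → 1`: a smooth central extension whose Lie
algebra is the level `k` affine algebra. The identification of the Lie algebra is given by the
left-invariant Maurer-Cartan form `(q^* μ, ν)` of `K`, so that `ν` is its central component. -/
structure LevelExtension (ip : LinearMap.BilinForm ℝ E) (k : ℤ) (K : Type*) [Group K]
    [DiffeologicalSpace K] where
  q : K →* LoopRot E G
  ι : Multiplicative UnitAddCircle →* K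
  ι_injective : Function.Injective ι
  q_surjective : Function.Surjective q
  exact : ι.range = q.ker
  central : ∀ (z : Multiplicative UnitAddCircle) (h : K), ι z * h = h * ι z
  smooth_mul : ∀ {n : ℕ} (h h' : Euc n → K), IsPlot h → IsPlot h' → IsPlot (fun u => h u * h' u)
  smooth_inv : ∀ {n : ℕ} (h : Euc n → K), IsPlot h → IsPlot (fun u => (h u)⁻¹)
  smooth_q : ∀ {n : ℕ} (h : Euc n → K), IsPlot h → SmoothLoopRot (fun u => q (h u))
  smooth_ι : ∀ {n : ℕ} (z : Euc n → UnitAddCircle), IsPlot (fun u => ι (.ofAdd (z u))) ↔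
    ∃ c : Euc n → ℝ, ContDiff ℝ ∞ c ∧ ∀ u, z u = (c u : UnitAddCircle)
  local_lift : ∀ {n : ℕ} (g : Euc n → LoopRot E G), SmoothLoopRot g → ∀ u, ∃ h : Euc n → K,
    IsPlot h ∧ ∀ᶠ u' in 𝓝 u, q (h u') = g u'
  ν : OneForm K ℝ SmoothReal
  ν_left : ∀ {n : ℕ} (a : K) (h : Euc n → K) (hh : IsPlot h)
    (hah : IsPlot (fun u => a * h u)) (u v : Euc n),
    ν.val (fun u' => a * h u') hah u v = ν.val h hh u v
  ν_central : ∀ {n : ℕ} (z : Euc n → UnitAddCircle) (hz : IsPlot (fun u => ι (.ofAdd (z u))))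
    (u v : Euc n), ν.val (fun u' => ι (.ofAdd (z u'))) hz u v = angleDeriv z u v
  /-- The Maurer-Cartan equation. -/
  structure_eq : ∀ {n : ℕ} (h : Euc n → K) (hh : IsPlot h) (u v w : Euc n),
    affCurv G ip k (fun u' v' =>
      sigma (maurerCartan (fun x => q (h x)) u' v') + centre (ν.val h hh u' v')) u v w = 0

end Geometry

/-! ### The lifting bundle gerbe and its principal module

The total space of the gerbe is `J = Q × K`, with `π₁ (ρ (q, h)) = q` and
`π₂ (ρ (q, h)) = q · [h]`, where `[h]` is the image of `h` in `𝕋 ⋉ LG`. -/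

section Gerbe

variable {E : Type*} [NormedAddCommGroup E] [NormedSpace ℝ E] {G : Type*}
    [TopologicalSpace G] [ChartedSpace E G] [Group G] [LieGroup 𝓘(ℝ, E) ∞ G]
    {Q : Type*} [DiffeologicalSpace Q] [MulAction (LoopRot E G)ᵐᵒᵖ Q]

/-- The lift `Ṽ = (1, -Φ, (k / 2) ⟪Φ, Φ⟫)` of the Higgs field. -/
def HiggsField.lift (ip : LinearMap.BilinForm ℝ E) (k : ℤ) (V : HiggsField E G Q) (q : Q) :
    AffAlg E :=
  (1, -V.Φ q, (k / 2 : ℝ) * loopPair ip (V.Φ q) (V.Φ q))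

/-- The bundle splitting defined by the Higgs field, with values in the centre: the pairing with
`Ṽ`, with the sign that makes it the identity on the centre. -/
def HiggsField.split (ip : LinearMap.BilinForm ℝ E) (k : ℤ) (V : HiggsField E G Q) (q : Q)
    (X : AffAlg E) : AffAlg E :=
  centre (-affPair ip k X (V.lift ip k q))

theorem HiggsField.split_centre (ip : LinearMap.BilinForm ℝ E) (k : ℤ) (V : HiggsField E G Q)
    (q : Q) (y : ℝ) : V.split ip k q (centre y) = centre y := by
  simp [HiggsField.split, HiggsField.lift, affPair, centre, loopPair]

/-- The curvature `F_L = (dλ, F_Λ)` of the connection `L`, on a plot. -/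
def Connection.curv (L : Connection E G Q) {n : ℕ} (p : Euc n → Q) (hp : IsPlot p)
    (u v w : Euc n) : RotAlg E :=
  rotCurv G (fun u' v' => L.form.val p hp u' v') u v w

/-- The exterior derivative `dλ` of the circle component of the connection. -/
def Connection.dlam (L : Connection E G Q) {n : ℕ} (p : Euc n → Q) (hp : IsPlot p)
    (u v w : Euc n) : ℝ :=
  extD (fun u' v' => (L.form.val p hp u' v').1) u v w

/-- The loop algebra component `F_Λ` of the curvature of the connection. -/
def Connection.curvLoop (L : Connection E G Q) {n : ℕ} (p : Euc n → Q) (hp : IsPlot p)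
    (u v w : Euc n) : UnitAddCircle → E :=
  (L.curv p hp u v w).2

/-- The curving `f = -(½ ω_σ(L, L) + s (σ F_L))` of the gerbe, a 2-form on `Q` with values in the
centre. -/
def curving (ip : LinearMap.BilinForm ℝ E) (k : ℤ) (L : Connection E G Q) (V : HiggsField E G Q)
    {n : ℕ} (p : Euc n → Q) (hp : IsPlot p) (u v w : Euc n) : AffAlg E :=
  -(omegaSigma G ip k (L.form.val p hp u v) (L.form.val p hp u w)
    + V.split ip k (p u) (sigma (L.curv p hp u v w)))

variable {ip : LinearMap.BilinForm ℝ E} {k : ℤ} {K : Type*} [Group K] [DiffeologicalSpace K]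

/-- The Maurer-Cartan form of `K`. -/
def LevelExtension.mc (ext : LevelExtension E G ip k K) {n : ℕ} (h : Euc n → K) (hh : IsPlot h)
    (u v : Euc n) : AffAlg E :=
  sigma (maurerCartan (fun x => ext.q (h x)) u v) + centre (ext.ν.val h hh u v)

/-- The connection `φ` of the principal module, a 1-form on `J = Q × K`: on the plot `(p, h)` it is
the Maurer-Cartan form of `h` plus `Ad_{h⁻¹} σ(L_p)`. -/
def principalConnection (ext : LevelExtension E G ip k K) (L : Connection E G Q) {n : ℕ}
    (p : Euc n → Q) (hp : IsPlot p) (h : Euc n → K) (hh : IsPlot h) (u v : Euc n) : AffAlg E :=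
  ext.mc h hh u v + affAd ip k (ext.q (h u))⁻¹ (sigma (L.form.val p hp u v))

/-- `𝓕` is the module curvature of the principal module:
`ρ^* π₂^* 𝓕 = F_φ + ρ^* π₁^* f` on `J`. -/
def IsPrincipalCurvature (ext : LevelExtension E G ip k K) (L : Connection E G Q)
    (V : HiggsField E G Q) (𝓕 : TwoForm Q (AffAlg E) (SmoothAff E)) : Prop :=
  ∀ {n : ℕ} (p : Euc n → Q) (hp : IsPlot p) (h : Euc n → K) (hh : IsPlot h)
    (hph : IsPlot (fun u => ract (p u) (ext.q (h u)))) (u v w : Euc n),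
    𝓕.val (fun u' => ract (p u') (ext.q (h u'))) hph u v w
      = affCurv G ip k (principalConnection ext L p hp h hh) u v w
        + curving ip k L V p hp u v w

end Gerbe

end LoopLift

end

/-! The connection on `J` is the gauge transform of `σ(L)` by `h`. Its curvature is therefore the
curvature of `σ(L)` moved by `Ad_{h⁻¹}` (`LevelExtension.affCurv_gauge`). Since `σ` is linear but
not a Lie homomorphism, `σ(L)` has curvature `σ(F_L) + ½ω_σ(L, L)` (`Connection.affCurv_sigma`). The
cocycle term is central, so `Ad` fixes it, and the curving cancels it. What remains on `J` is
`Ad_{h⁻¹} σ(F_L) - s_p(σ(F_L))`.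

The pairing is invariant and `Ṽ` is equivariant, so `s_p(X) = s_{p·q(h)}(Ad_{h⁻¹} X)`
(`HiggsField.split_affAd`). The remainder is thus `(1 - s) Ad_{h⁻¹} σ(F_L)`, with `s` taken at
`p·q(h)`. As `s` is the identity on the centre, `1 - s` sees its argument only modulo the centre
(`HiggsField.horizontal_proj`). Modulo the centre the connection on `J` is `L` pulled back along
`p·q(h)` (`Connection.form_ract`), so `Ad_{h⁻¹} σ(F_L)` projects to `F_L` at the second endpoint.
This gives `(1 - s) σ(F_L)` there; the triple is the pairing with `Ṽ` written out
(`HiggsField.horizontal_eq`). Uniqueness follows by taking `h = 1`.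

The gauge formula needs `Ad_{h⁻¹}` to preserve the affine bracket
(`LevelExtension.affAd_affBracket`) and to have derivative `-[h⁻¹dh, Ad_{h⁻¹} ·]`
(`LevelExtension.dAff_affAd`). Both rest on the Maurer-Cartan equation in `G`, which the structure
equation of the extension yields on constant loops (`LevelExtension.maurerCartan_euc`). Applied to
products of maps into `G`, that equation gives the derivative of `Ad`, the compatibility of `Ad`
with the bracket and, with the invariance of `ip`, its infinitesimal invariance. Integration by
parts on the circle handles the central components. -/

noncomputable section

namespace LoopLift

open MeasureTheory

set_option linter.unusedSectionVars false

/-! ### Logarithmic derivatives and the adjoint action on `G` -/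

section LieCalculus

variable {E : Type*} [NormedAddCommGroup E] [NormedSpace ℝ E]
variable {G : Type*} [TopologicalSpace G] [ChartedSpace E G] [Group G] [LieGroup 𝓘(ℝ, E) ∞ G]
variable {W : Type*} [NormedAddCommGroup W] [NormedSpace ℝ W]

/-- The derivative of a map to `G`, as a linear map to the model space. -/
def tder (f : W → G) (w : W) : W →L[ℝ] E := mfderiv 𝓘(ℝ, W) 𝓘(ℝ, E) f w

/-- Near the identity, the product of a Lie group is the sum to first order. -/
theorem tder_mul_of_eq_one {p q : W → G} {w : W} (hp : MDifferentiableAt 𝓘(ℝ, W) 𝓘(ℝ, E) p w)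
    (hq : MDifferentiableAt 𝓘(ℝ, W) 𝓘(ℝ, E) q w) (hp1 : p w = 1) (hq1 : q w = 1) (v : W) :
    (tder (fun w' => p w' * q w') w v : E) = tder p w v + tder q w v := by
  have hm : MDifferentiableAt (𝓘(ℝ, E).prod 𝓘(ℝ, E)) 𝓘(ℝ, E) (fun z : G × G => z.1 * z.2)
      ((1 : G), (1 : G)) :=
    (contMDiff_mul 𝓘(ℝ, E) ∞).mdifferentiable (by simp) _
  have h1 : mfderiv 𝓘(ℝ, W) 𝓘(ℝ, E) (fun w' => p w' * q w') w v =
      mfderiv (𝓘(ℝ, E).prod 𝓘(ℝ, E)) 𝓘(ℝ, E) (fun z : G × G => z.1 * z.2) ((1 : G), (1 : G))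
        (mfderiv 𝓘(ℝ, W) (𝓘(ℝ, E).prod 𝓘(ℝ, E)) (fun w' => (p w', q w')) w v) :=
    mfderiv_comp_apply_of_eq w (g := fun z : G × G => z.1 * z.2) (f := fun w' => (p w', q w'))
      hm (hp.prodMk hq) (by simp [hp1, hq1]) v
  refine h1.trans ?_
  have h2 : (mfderiv 𝓘(ℝ, W) (𝓘(ℝ, E).prod 𝓘(ℝ, E)) (fun w' => (p w', q w')) w v : E × E)
      = (tder p w v, tder q w v) := DFunLike.congr_fun (mfderiv_prodMk hp hq) v
  refine (congrArg (mfderiv (𝓘(ℝ, E).prod 𝓘(ℝ, E)) 𝓘(ℝ, E) (fun z : G × G => z.1 * z.2)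
    ((1 : G), (1 : G))) h2).trans ((mfderiv_prod_eq_add_apply hm).trans ?_)
  have e1 : (fun z : G => z * (1 : G)) = id := by ext; simp
  have e2 : (fun z : G => (1 : G) * z) = id := by ext; simp
  have k1 : ∀ x : E, (mfderiv 𝓘(ℝ, E) 𝓘(ℝ, E) (fun z : G => z * (1 : G)) 1 x : E) = x := by
    rw [e1, mfderiv_id]
    exact fun _ => rfl
  have k2 : ∀ x : E, (mfderiv 𝓘(ℝ, E) 𝓘(ℝ, E) (fun z : G => (1 : G) * z) 1 x : E) = x := by
    rw [e2, mfderiv_id]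
    exact fun _ => rfl
  exact congrArg₂ (· + ·) (k1 _) (k2 _)

theorem mdifferentiable_conj (g : G) :
    MDifferentiable 𝓘(ℝ, E) 𝓘(ℝ, E) (fun a : G => g * a * g⁻¹) :=
  ((contMDiff_const.mul contMDiff_id).mul contMDiff_const :
    ContMDiff 𝓘(ℝ, E) 𝓘(ℝ, E) ∞ (fun a : G => g * a * g⁻¹)).mdifferentiable (by simp)

/-- The adjoint action as a linear map. -/
def gAdL (g : G) : E →L[ℝ] E := mfderiv 𝓘(ℝ, E) 𝓘(ℝ, E) (fun a : G => g * a * g⁻¹) 1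

theorem gAdL_apply (g : G) (x : E) : gAdL g x = gAd g x := rfl

/-- The logarithmic derivative as a linear map. -/
def logDerivL (c : W → G) (w : W) : W →L[ℝ] E :=
  mfderiv 𝓘(ℝ, W) 𝓘(ℝ, E) (fun w' => (c w)⁻¹ * c w') w

theorem logDerivL_apply (c : W → G) (w v : W) : (logDerivL c w v : E) = logDeriv c w v := rfl

theorem tder_conj_comp {f : W → G} {w : W} (hf : MDifferentiableAt 𝓘(ℝ, W) 𝓘(ℝ, E) f w)
    (hf1 : f w = 1) (g : G) (v : W) :
    (tder (fun w' => g * f w' * g⁻¹) w v : E) = gAd g (tder f w v) :=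
  mfderiv_comp_apply_of_eq w (g := fun a : G => g * a * g⁻¹) (mdifferentiable_conj g 1) hf hf1 v

theorem gAd_mul (g h : G) (x : E) : gAd (g * h) x = gAd g (gAd h x) := by
  have h1 : (fun a : G => g * h * a * (g * h)⁻¹)
      = (fun a : G => g * a * g⁻¹) ∘ (fun a : G => h * a * h⁻¹) := by
    ext a; simp [mul_assoc]
  unfold gAd
  rw [h1]
  exact mfderiv_comp_apply_of_eq (1 : G) (mdifferentiable_conj g 1) (mdifferentiable_conj h 1)
    (by simp) x

theorem gAd_one (x : E) : gAd (1 : G) x = x := by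
  have h1 : (fun a : G => 1 * a * (1 : G)⁻¹) = id := by ext a; simp
  unfold gAd
  rw [h1, mfderiv_id]
  rfl

theorem gAd_gAd_inv (g : G) (x : E) : gAd g (gAd g⁻¹ x) = x := by
  rw [← gAd_mul, mul_inv_cancel, gAd_one]

theorem gAd_inv_gAd (g : G) (x : E) : gAd g⁻¹ (gAd g x) = x := by
  rw [← gAd_mul, inv_mul_cancel, gAd_one]

theorem gAd_add (g : G) (x y : E) : gAd g (x + y) = gAd g x + gAd g y := (gAdL g).map_add x y
theorem gAd_sub (g : G) (x y : E) : gAd g (x - y) = gAd g x - gAd g y := (gAdL g).map_sub x y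
theorem gAd_neg (g : G) (x : E) : gAd g (-x) = -gAd g x := (gAdL g).map_neg x
theorem gAd_smul (g : G) (r : ℝ) (x : E) : gAd g (r • x) = r • gAd g x := (gAdL g).map_smul r x
theorem gAd_zero (g : G) : gAd g (0 : E) = 0 := (gAdL g).map_zero

/-- Normalised to be `1` at `w`, the product `ab` is `b(w)⁻¹ (a(w)⁻¹ a) b(w)` times `b(w)⁻¹ b`. Both
factors are `1` at `w`, where multiplication is addition to first order. -/
theorem logDeriv_mul {a b : W → G} {w : W} (ha : MDifferentiableAt 𝓘(ℝ, W) 𝓘(ℝ, E) a w)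
    (hb : MDifferentiableAt 𝓘(ℝ, W) 𝓘(ℝ, E) b w) (v : W) :
    (logDeriv (fun w' => a w' * b w') w v : E)
      = gAd (b w)⁻¹ (logDeriv a w v) + logDeriv b w v := by
  have hl : ∀ g : G, MDifferentiable 𝓘(ℝ, E) 𝓘(ℝ, E) (fun a : G => g * a) := fun g =>
    (contMDiff_mul_left (I := 𝓘(ℝ, E)) (n := ∞) (a := g)).mdifferentiable (by simp)
  have ha' : MDifferentiableAt 𝓘(ℝ, W) 𝓘(ℝ, E) (fun w' => (a w)⁻¹ * a w') w :=
    (hl (a w)⁻¹ _).comp w ha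
  have hb' : MDifferentiableAt 𝓘(ℝ, W) 𝓘(ℝ, E) (fun w' => (b w)⁻¹ * b w') w :=
    (hl (b w)⁻¹ _).comp w hb
  have h1 : (fun w' => (a w * b w)⁻¹ * (a w' * b w')) = fun w' =>
      ((b w)⁻¹ * ((a w)⁻¹ * a w') * ((b w)⁻¹)⁻¹) * ((b w)⁻¹ * b w') := by
    ext w'; group
  change (tder (fun w' => (a w * b w)⁻¹ * (a w' * b w')) w v : E) =
    gAd (b w)⁻¹ (tder (fun w' => (a w)⁻¹ * a w') w v) + tder (fun w' => (b w)⁻¹ * b w') w v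
  rw [h1, tder_mul_of_eq_one _ hb' (by simp) (by simp)]
  · rw [tder_conj_comp ha' (by simp)]
  · exact (mdifferentiable_conj (b w)⁻¹ _).comp w ha'

theorem logDeriv_const (g : G) (w v : W) : (logDeriv (fun _ : W => g) w v : E) = 0 := by
  change (tder (fun _ : W => g⁻¹ * g) w v : E) = 0
  unfold tder
  rw [mfderiv_const]
  rfl

theorem logDeriv_inv {a : W → G} {w : W} (ha : MDifferentiableAt 𝓘(ℝ, W) 𝓘(ℝ, E) a w) (v : W) :
    (logDeriv (fun w' => (a w')⁻¹) w v : E) = -gAd (a w) (logDeriv a w v) := by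
  have hi : MDifferentiableAt 𝓘(ℝ, W) 𝓘(ℝ, E) (fun w' => (a w')⁻¹) w :=
    ((contMDiff_inv 𝓘(ℝ, E) ∞).mdifferentiable (by simp) (a w)).comp w ha
  have h := logDeriv_mul ha hi v
  simp only [mul_inv_cancel, inv_inv] at h
  rw [logDeriv_const] at h
  exact (neg_eq_of_add_eq_zero_right h.symm).symm

theorem logDeriv_comp {W' : Type*} [NormedAddCommGroup W'] [NormedSpace ℝ W'] {c : W → G}
    {f : W' → W} {w : W'} (hc : MDifferentiableAt 𝓘(ℝ, W) 𝓘(ℝ, E) c (f w))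
    (hf : DifferentiableAt ℝ f w) (v : W') :
    (logDeriv (fun w' => c (f w')) w v : E) = logDeriv c (f w) (fderiv ℝ f w v) := by
  have hl : MDifferentiable 𝓘(ℝ, E) 𝓘(ℝ, E) (fun a : G => (c (f w))⁻¹ * a) :=
    (contMDiff_mul_left (I := 𝓘(ℝ, E)) (n := ∞)).mdifferentiable (by simp)
  have h := mfderiv_comp_apply (g := fun w' => (c (f w))⁻¹ * c w') (f := f) w
    ((hl _).comp _ hc) hf.mdifferentiableAt v
  have h2 : mfderiv 𝓘(ℝ, W') 𝓘(ℝ, W) f w v = fderiv ℝ f w v :=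
    DFunLike.congr_fun mfderiv_eq_fderiv v
  rw [h2] at h
  exact h

/-- The normalised map takes the value `1` at `w`, so the fixed chart at `1` serves for every `w`.
This makes dependence on `w` accessible to ordinary calculus. -/
theorem logDeriv_eq_fderiv {c : W → G} {w : W} (hc : MDifferentiableAt 𝓘(ℝ, W) 𝓘(ℝ, E) c w)
    (v : W) : (logDeriv c w v : E)
      = fderiv ℝ (fun w' => extChartAt 𝓘(ℝ, E) (1 : G) ((c w)⁻¹ * c w')) w v := by
  have hl : MDifferentiable 𝓘(ℝ, E) 𝓘(ℝ, E) (fun a : G => (c w)⁻¹ * a) :=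
    (contMDiff_mul_left (I := 𝓘(ℝ, E)) (n := ∞)).mdifferentiable (by simp)
  have hd : MDifferentiableAt 𝓘(ℝ, W) 𝓘(ℝ, E) (fun w' => (c w)⁻¹ * c w') w := (hl _).comp _ hc
  have h : logDerivL c w = fderivWithin ℝ (writtenInExtChartAt 𝓘(ℝ, W) 𝓘(ℝ, E) w
      (fun w' => (c w)⁻¹ * c w')) (Set.range 𝓘(ℝ, W)) (extChartAt 𝓘(ℝ, W) w w) := if_pos hd
  rw [← logDerivL_apply, h]
  simp [writtenInExtChartAt, fderivWithin_univ, Function.comp_def]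
  rfl

theorem contMDiffAt_chart_one :
    ContMDiffAt 𝓘(ℝ, E) 𝓘(ℝ, E) ∞ (extChartAt 𝓘(ℝ, E) (1 : G)) (1 : G) :=
  contMDiffAt_extChartAt

theorem contDiff_logDeriv {c : W → G} (hc : ContMDiff 𝓘(ℝ, W) 𝓘(ℝ, E) ∞ c) :
    ContDiff ℝ ∞ (fun w => (logDerivL c w : W →L[ℝ] E)) := by
  have h : (fun w => (logDerivL c w : W →L[ℝ] E)) = fun w =>
      fderiv ℝ (fun w' => extChartAt 𝓘(ℝ, E) (1 : G) ((c w)⁻¹ * c w')) w := by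
    ext w v
    rw [logDerivL_apply]
    exact logDeriv_eq_fderiv (hc.mdifferentiable (by simp) w) v
  rw [h, contDiff_iff_contDiffAt]
  intro w
  -- The point `w` plays two roles, as parameter of the normalised map and as point of
  -- differentiation; joint smoothness in both variables suffices.
  refine ContDiffAt.fderiv (n := ∞)
    (f := fun w w' => extChartAt 𝓘(ℝ, E) (1 : G) ((c w)⁻¹ * c w')) ?_ contDiffAt_id (by simp)
  rw [← contMDiffAt_iff_contDiffAt]
  have h2 : ContMDiff 𝓘(ℝ, W × W) 𝓘(ℝ, E) ∞ (fun z : W × W => (c z.1)⁻¹ * c z.2) :=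
    (hc.comp contDiff_fst.contMDiff).inv.mul (hc.comp contDiff_snd.contMDiff)
  exact ContMDiffAt.comp_of_eq (contMDiffAt_chart_one (G := G)) (h2 (w, w)) (by simp)

theorem gAd_eq_fderiv (g : G) (x : E) : gAd g x
      = fderiv ℝ (fun y => extChartAt 𝓘(ℝ, E) (1 : G)
          (g * (extChartAt 𝓘(ℝ, E) (1 : G)).symm y * g⁻¹)) (extChartAt 𝓘(ℝ, E) (1 : G) 1) x := by
  have h : gAdL g = fderivWithin ℝ (writtenInExtChartAt 𝓘(ℝ, E) 𝓘(ℝ, E) (1 : G)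
      (fun a : G => g * a * g⁻¹)) (Set.range 𝓘(ℝ, E)) (extChartAt 𝓘(ℝ, E) (1 : G) 1) :=
    if_pos (mdifferentiable_conj g 1)
  rw [← gAdL_apply, h]
  simp [writtenInExtChartAt, fderivWithin_univ, Function.comp_def]

theorem contDiff_gAdL {c : W → G} (hc : ContMDiff 𝓘(ℝ, W) 𝓘(ℝ, E) ∞ c) :
    ContDiff ℝ ∞ (fun w => (gAdL (c w) : E →L[ℝ] E)) := by
  have h : (fun w => (gAdL (c w) : E →L[ℝ] E)) = fun w =>
      fderiv ℝ (fun y => extChartAt 𝓘(ℝ, E) (1 : G)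
          (c w * (extChartAt 𝓘(ℝ, E) (1 : G)).symm y * (c w)⁻¹))
            (extChartAt 𝓘(ℝ, E) (1 : G) 1) := by
    ext w v
    rw [gAdL_apply, gAd_eq_fderiv]
  rw [h, contDiff_iff_contDiffAt]
  intro w
  refine ContDiffAt.fderiv (n := ∞)
    (f := fun w y => extChartAt 𝓘(ℝ, E) (1 : G)
          (c w * (extChartAt 𝓘(ℝ, E) (1 : G)).symm y * (c w)⁻¹)) ?_ contDiffAt_const (by simp)
  rw [← contMDiffAt_iff_contDiffAt]
  have hs : ContMDiffAt 𝓘(ℝ, E) 𝓘(ℝ, E) ∞ (extChartAt 𝓘(ℝ, E) (1 : G)).symm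
      (extChartAt 𝓘(ℝ, E) (1 : G) 1) :=
    (contMDiffOn_extChartAt_symm (1 : G)).contMDiffAt (extChartAt_target_mem_nhds (1 : G))
  have h1 : ContMDiff 𝓘(ℝ, W × E) 𝓘(ℝ, E) ∞ (fun z : W × E => c z.1) :=
    hc.comp contDiff_fst.contMDiff
  have h3 : ContMDiffAt 𝓘(ℝ, W × E) 𝓘(ℝ, E) ∞
      (fun z : W × E => (extChartAt 𝓘(ℝ, E) (1 : G)).symm z.2)
      (w, extChartAt 𝓘(ℝ, E) (1 : G) 1) :=
    ContMDiffAt.comp_of_eq hs (contDiff_snd.contMDiff _) rfl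
  refine ContMDiffAt.comp_of_eq (contMDiffAt_chart_one (G := G))
    ((h1.contMDiffAt.mul h3).mul h1.contMDiffAt.inv) (by simp)

end LieCalculus

/-! ### Bilinearity of the bracket of the Lie algebra of `G` -/

section Bracket

variable {E : Type*} [NormedAddCommGroup E] [NormedSpace ℝ E] [CompleteSpace E]
variable (G : Type*) [TopologicalSpace G] [ChartedSpace E G] [Group G] [LieGroup 𝓘(ℝ, E) ∞ G]

/-- The Lie ring structure on `GroupLieAlgebra` asks for this order of smoothness, which is `3` over
`ℝ`. -/
theorem lieGroup_minSmoothness : LieGroup 𝓘(ℝ, E) (minSmoothness ℝ 3) G := by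
  refine LieGroup.of_le (n := ∞) ?_
  rw [minSmoothness_of_isRCLikeNormedField]
  exact WithTop.coe_le_coe.2 le_top

theorem gBracket_add_left (x y z : E) :
    gBracket G (x + y) z = gBracket G x z + gBracket G y z := by
  have := lieGroup_minSmoothness (E := E) G
  exact add_lie (L := GroupLieAlgebra 𝓘(ℝ, E) G) (M := GroupLieAlgebra 𝓘(ℝ, E) G) x y z

theorem gBracket_add_right (x y z : E) :
    gBracket G x (y + z) = gBracket G x y + gBracket G x z := by
  have := lieGroup_minSmoothness (E := E) G
  exact lie_add (L := GroupLieAlgebra 𝓘(ℝ, E) G) (M := GroupLieAlgebra 𝓘(ℝ, E) G) x y z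

theorem gBracket_self (x : E) : gBracket G x x = 0 := by
  have := lieGroup_minSmoothness (E := E) G
  exact lie_self (L := GroupLieAlgebra 𝓘(ℝ, E) G) x

theorem gBracket_smul_right (r : ℝ) (x y : E) :
    gBracket G x (r • y) = r • gBracket G x y := by
  have := lieGroup_minSmoothness (E := E) G
  exact lie_smul (R := ℝ) (L := GroupLieAlgebra 𝓘(ℝ, E) G) (M := GroupLieAlgebra 𝓘(ℝ, E) G) r x y

theorem gBracket_skew (x y : E) : gBracket G x y = -gBracket G y x := by
  have := lieGroup_minSmoothness (E := E) G
  exact (lie_skew (L := GroupLieAlgebra 𝓘(ℝ, E) G) x y).symm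

/-- The bracket as a bilinear map. -/
def gBracketL : E →ₗ[ℝ] E →ₗ[ℝ] E :=
  LinearMap.mk₂ ℝ (gBracket G) (gBracket_add_left G)
    (fun r x y => by
      rw [gBracket_skew G (r • x), gBracket_smul_right, gBracket_skew G y, smul_neg, neg_neg])
    (gBracket_add_right G) (gBracket_smul_right G)

end Bracket

/-! ### Derivatives of circle-valued maps -/

section Angle

variable {W : Type*} [NormedAddCommGroup W] [NormedSpace ℝ W]

/-- The function `sin (2πx) / (2π)` has derivative `1` at `0`. -/
theorem angleDeriv_coe {c : W → ℝ} {u : W} (hc : DifferentiableAt ℝ c u) (v : W) :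
    angleDeriv (fun w => (c w : UnitAddCircle)) u v = fderiv ℝ c u v := by
  have h1 : (fun w => ((AddCircle.toCircle ((c w : UnitAddCircle) - (c u : UnitAddCircle)) :
      Circle) : ℂ).im / (2 * Real.pi)) =
      fun w => Real.sin (2 * Real.pi * (c w - c u)) / (2 * Real.pi) := by
    ext w
    rw [← AddCircle.coe_sub, AddCircle.toCircle_apply_mk, Circle.coe_exp, Complex.exp_ofReal_mul_I_im]
    simp
  have h2 : HasFDerivAt (fun w => Real.sin (2 * Real.pi * (c w - c u)) / (2 * Real.pi))
      (fderiv ℝ c u) u := by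
    have h3 := ((hc.hasFDerivAt.sub_const (c u)).const_mul (2 * Real.pi)).sin.mul_const
      (2 * Real.pi)⁻¹
    simp only [← div_eq_mul_inv] at h3
    refine h3.congr_fderiv ?_
    ext x
    simp
    field_simp
  unfold angleDeriv
  rw [h1, h2.fderiv]

theorem angleDeriv_congr {c d : W → UnitAddCircle} {u : W} (h : c =ᶠ[𝓝 u] d) (v : W) :
    angleDeriv c u v = angleDeriv d u v := by
  unfold angleDeriv
  rw [Filter.EventuallyEq.fderiv_eq]
  filter_upwards [h] with w hw
  rw [hw, h.self_of_nhds]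

end Angle

/-! ### The Maurer-Cartan equation in `G`, extracted from the extension -/

section MaurerCartan

variable {E : Type*} [NormedAddCommGroup E] [NormedSpace ℝ E]
variable {G : Type*} [TopologicalSpace G] [ChartedSpace E G] [Group G] [LieGroup 𝓘(ℝ, E) ∞ G]
variable {W : Type*} [NormedAddCommGroup W] [NormedSpace ℝ W]

theorem logDeriv_congr {c d : W → G} {w : W} (h : c =ᶠ[𝓝 w] d) (v : W) :
    (logDeriv c w v : E) = logDeriv d w v := by
  have h1 : (fun w' => (c w)⁻¹ * c w') =ᶠ[𝓝 w] fun w' => (d w)⁻¹ * d w' := by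
    filter_upwards [h] with w' hw
    rw [hw, h.self_of_nhds]
  exact DFunLike.congr_fun (F := W →L[ℝ] E) h1.mfderiv_eq v

/-- The family of constant loops given by a family of elements of `G`. -/
def constLoopRot {n : ℕ} (c : Euc n → G) (z : Euc n) : LoopRot E G :=
  ⟨⟨fun _ => c z, contMDiff_const⟩, 1⟩

theorem smoothLoopRot_const {n : ℕ} {c : Euc n → G} (hc : ContMDiff 𝓘(ℝ, Euc n) 𝓘(ℝ, E) ∞ c) :
    SmoothLoopRot (constLoopRot (E := E) c) :=
  ⟨⟨fun _ => 0, contDiff_const, fun _ => by simp [LoopRot.angle, constLoopRot]⟩,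
    hc.comp contDiff_fst.contMDiff⟩

variable {ip : LinearMap.BilinForm ℝ E} {k : ℤ} {K : Type*} [Group K] [DiffeologicalSpace K]

/-- A family of constant loops with zero angle lifts locally to `K`. Its circle component vanishes,
so no loop derivatives enter the bracket, and the loop component of the structure equation at `θ =
0` is the equation in `G`. -/
theorem LevelExtension.maurerCartan_euc (ext : LevelExtension E G ip k K) {n : ℕ} {c : Euc n → G}
    (hc : ContMDiff 𝓘(ℝ, Euc n) 𝓘(ℝ, E) ∞ c) (u x y : Euc n) :
    fderiv ℝ (fun w => (logDeriv c w y : E)) u x - fderiv ℝ (fun w => (logDeriv c w x : E)) u y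
      + gBracket G (logDeriv c u x) (logDeriv c u y) = 0 := by
  obtain ⟨h, hh, hq⟩ := ext.local_lift _ (smoothLoopRot_const hc) u
  have key : ∀ᶠ u' in 𝓝 u, ∀ v θ,
      (maurerCartan (fun x => ext.q (h x)) u' v : RotAlg E).2 θ = logDeriv c u' v := by
    -- The Maurer-Cartan form at a nearby `u'` is itself a derivative, so the lift must agree with
    -- the family on a neighbourhood of `u'`.
    filter_upwards [hq.eventually_nhds] with u' hu' v θ
    change (logDeriv (fun w => (ext.q (h w)).loop (θ - (ext.q (h u')).angle)) u' v : E) = _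
    refine logDeriv_congr (E := E) (G := G) ?_ v
    filter_upwards [hu'] with w hw
    simp [hw, LoopRot.loop, constLoopRot]
  have hang : ∀ v, (maurerCartan (fun x => ext.q (h x)) u v : RotAlg E).1 = 0 := by
    intro v
    have h0 : (fun w => (ext.q (h w)).angle) =ᶠ[𝓝 u] fun _ => ((0 : ℝ) : UnitAddCircle) := by
      filter_upwards [hq] with w hw
      rw [hw]
      simp [LoopRot.angle, constLoopRot]
    change angleDeriv _ u v = 0
    rw [angleDeriv_congr h0, angleDeriv_coe (differentiableAt_const _)]
    simp
  have hd : ∀ v w, fderiv ℝ (fun u' => (maurerCartan (fun x => ext.q (h x)) u' v : RotAlg E).2 0) u w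
      = fderiv ℝ (fun u' => (logDeriv c u' v : E)) u w := by
    intro v w
    rw [Filter.EventuallyEq.fderiv_eq]
    filter_upwards [key] with u' hu'
    exact hu' v 0
  have h1 := congr_fun (congrArg (fun X : AffAlg E => X.2.1) (ext.structure_eq h hh u x y)) 0
  simp only [affCurv, extDLoop, extD, affBracket, sigma, centre, Prod.snd_add, Prod.fst_add,
    Pi.add_apply, add_zero, hang, zero_smul, sub_zero, hd,
    key.self_of_nhds, Prod.snd_zero, Prod.fst_zero, Pi.zero_apply] at h1
  exact h1

/-- The Maurer-Cartan equation in `G`. -/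
theorem LevelExtension.maurerCartan_eq [CompleteSpace E] (ext : LevelExtension E G ip k K) {c : W → G}
    (hc : ContMDiff 𝓘(ℝ, W) 𝓘(ℝ, E) ∞ c) (u x y : W) :
    fderiv ℝ (fun w => (logDeriv c w y : E)) u x - fderiv ℝ (fun w => (logDeriv c w x : E)) u y
      + gBracket G (logDeriv c u x) (logDeriv c u y) = 0 := by
  -- Only two directions matter: pull `c` back to the plane through `u` spanned by `x` and `y`,
  -- where plots of `K` are available.
  let A : Euc 2 →L[ℝ] W :=
    (EuclideanSpace.proj (0 : Fin 2) : Euc 2 →L[ℝ] ℝ).smulRight x +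
      (EuclideanSpace.proj (1 : Fin 2) : Euc 2 →L[ℝ] ℝ).smulRight y
  let f : Euc 2 → W := fun z => u + A z
  have hf : ContDiff ℝ ∞ f := contDiff_const.add A.contDiff
  have hf' : ∀ z, fderiv ℝ f z = A := fun z => by
    simp only [f]
    rw [fderiv_const_add, A.fderiv]
  have h0 : A (EuclideanSpace.single 0 1) = x := by simp [A]
  have h1 : A (EuclideanSpace.single 1 1) = y := by simp [A]
  have hl : ∀ z v, (logDeriv (fun z => c (f z)) z v : E) = logDeriv c (f z) (A v) := fun z v => by
    rw [logDeriv_comp (hc.mdifferentiable (by simp) _) (hf.differentiable (by simp) _), hf']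
  have hfd : ∀ v w : W, ∀ a : Euc 2, A a = v → fderiv ℝ (fun z => (logDeriv c (f z) w : E)) 0 a
      = fderiv ℝ (fun z => (logDeriv c z w : E)) u v := by
    intro v w a ha
    have hs : ContDiff ℝ ∞ (fun z => (logDeriv c z w : E)) :=
      (contDiff_logDeriv hc).clm_apply contDiff_const
    have hf0 : f 0 = u := by simp [f]
    have := fderiv_comp (𝕜 := ℝ) (g := fun z => (logDeriv c z w : E)) (f := f) 0
      (hs.differentiable (by simp) _) (hf.differentiable (by simp) _)
    rw [hf0, hf'] at this
    have h2 := DFunLike.congr_fun this a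
    rw [ContinuousLinearMap.comp_apply, ha] at h2
    exact h2
  have h2 := ext.maurerCartan_euc (c := fun z => c (f z)) (hc.comp hf.contMDiff) 0
    (EuclideanSpace.single 0 1) (EuclideanSpace.single 1 1)
  simp only [hl, h0, h1] at h2
  rw [hfd x y _ h0, hfd y x _ h1] at h2
  simpa [f] using h2

end MaurerCartan

/-! ### Bilinear maps in finite dimension -/

section FiniteDimensional

variable {E : Type*} [NormedAddCommGroup E] [NormedSpace ℝ E] [FiniteDimensional ℝ E]
variable {F : Type*} [NormedAddCommGroup F] [NormedSpace ℝ F]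

/-- A bilinear map on a finite-dimensional space, as a continuous bilinear map. -/
def bilinL (B : E →ₗ[ℝ] E →ₗ[ℝ] F) : E →L[ℝ] E →L[ℝ] F :=
  LinearMap.toContinuousLinearMap
    ((LinearMap.toContinuousLinearMap : (E →ₗ[ℝ] F) ≃ₗ[ℝ] (E →L[ℝ] F)).toLinearMap ∘ₗ B)

variable {W : Type*} [NormedAddCommGroup W] [NormedSpace ℝ W]

theorem contDiff_bilin (B : E →ₗ[ℝ] E →ₗ[ℝ] F) {f g : W → E} (hf : ContDiff ℝ ∞ f)
    (hg : ContDiff ℝ ∞ g) : ContDiff ℝ ∞ (fun w => B (f w) (g w)) :=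
  ((bilinL B).contDiff.comp hf).clm_apply hg

theorem fderiv_bilin (B : E →ₗ[ℝ] E →ₗ[ℝ] F) {f g : W → E} {u : W} (hf : DifferentiableAt ℝ f u)
    (hg : DifferentiableAt ℝ g u) (v : W) : fderiv ℝ (fun w => B (f w) (g w)) u v
      = B (fderiv ℝ f u v) (g u) + B (f u) (fderiv ℝ g u v) := by
  have h := DFunLike.congr_fun
    ((bilinL B).hasFDerivAt_of_bilinear hf.hasFDerivAt hg.hasFDerivAt).fderiv v
  rw [add_comm]
  exact h

end FiniteDimensional

/-! ### Consequences of the Maurer-Cartan equation for `Ad` and the bracket -/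

section MaurerCartan

variable {E : Type*} [NormedAddCommGroup E] [NormedSpace ℝ E] [FiniteDimensional ℝ E]
variable {G : Type*} [TopologicalSpace G] [ChartedSpace E G] [Group G] [LieGroup 𝓘(ℝ, E) ∞ G]
variable {W : Type*} [NormedAddCommGroup W] [NormedSpace ℝ W]

variable (G) in
-- Stands in for the exponential map: the inverse chart at `1` is applied to `A`, cut off by a bump
-- function so that the argument never leaves the chart's target. Near `0` the cutoff is `1`.
theorem exists_smooth_logDeriv_eq (A : W →L[ℝ] E) : ∃ b : W → G,
    ContMDiff 𝓘(ℝ, W) 𝓘(ℝ, E) ∞ b ∧ b 0 = 1 ∧ ∀ v, (logDeriv b 0 v : E) = A v := by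
  set ψ := extChartAt 𝓘(ℝ, E) (1 : G) with hψ
  obtain ⟨r, hr, hrt⟩ := Metric.mem_nhds_iff.1 (extChartAt_target_mem_nhds (I := 𝓘(ℝ, E)) (1 : G))
  let f : ContDiffBump (0 : E) := ⟨r / 2, r, by positivity, by linarith⟩
  let j : W → E := fun w => ψ 1 + f (A w) • A w
  have hj : ContDiff ℝ ∞ j :=
    contDiff_const.add ((f.contDiff.comp A.contDiff).smul A.contDiff)
  have hjt : ∀ w, j w ∈ ψ.target := by
    intro w
    apply hrt
    rw [mem_ball_iff_norm]
    simp only [j, hψ, add_sub_cancel_left]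
    by_cases hw : ‖A w‖ < r
    · rw [norm_smul, Real.norm_of_nonneg f.nonneg]
      exact (mul_le_of_le_one_left (norm_nonneg _) f.le_one).trans_lt hw
    · rw [f.zero_of_le_dist (by simpa using not_lt.1 hw)]
      simpa using hr
  have hb : ContMDiff 𝓘(ℝ, W) 𝓘(ℝ, E) ∞ (fun w => ψ.symm (j w)) :=
    (contMDiffOn_extChartAt_symm (1 : G)).comp_contMDiff hj.contMDiff hjt
  have hj0 : j 0 = ψ 1 := by simp [j]
  have hb0 : ψ.symm (j 0) = 1 := by
    rw [hj0]
    exact extChartAt_to_inv (1 : G)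
  refine ⟨_, hb, hb0, fun v => ?_⟩
  rw [logDeriv_eq_fderiv (hb.mdifferentiable (by simp) _), hb0]
  simp only [inv_one, one_mul]
  have h1 : (fun w => ψ (ψ.symm (j w))) =ᶠ[𝓝 0] fun w => ψ 1 + A w := by
    have h2 : ∀ᶠ w in 𝓝 (0 : W), A w ∈ Metric.closedBall (0 : E) (r / 2) := by
      refine A.continuous.continuousAt.eventually_mem ?_
      rw [map_zero]
      exact Metric.closedBall_mem_nhds _ (by positivity)
    filter_upwards [h2] with w hw
    rw [ψ.right_inv (hjt w)]
    simp only [j]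
    rw [f.one_of_mem_closedBall hw, one_smul]
  rw [h1.fderiv_eq, fderiv_const_add, A.fderiv]

variable {ip : LinearMap.BilinForm ℝ E} {k : ℤ} {K : Type*} [Group K] [DiffeologicalSpace K]

theorem contDiff_gAd_inv {c : W → G} (hc : ContMDiff 𝓘(ℝ, W) 𝓘(ℝ, E) ∞ c) {ξ : W → E}
    (hξ : ContDiff ℝ ∞ ξ) : ContDiff ℝ ∞ (fun w => gAd (c w)⁻¹ (ξ w)) :=
  (contDiff_gAdL hc.inv).clm_apply hξ

theorem contDiff_logDeriv_apply {c : W → G} (hc : ContMDiff 𝓘(ℝ, W) 𝓘(ℝ, E) ∞ c) {ξ : W → W}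
    (hξ : ContDiff ℝ ∞ ξ) : ContDiff ℝ ∞ (fun w => (logDeriv c w (ξ w) : E)) :=
  (contDiff_logDeriv hc).clm_apply hξ

/-- Apply the Maurer-Cartan equation to `b(t) c(w)`, where `b` leaves `1` with velocity `x`. At `t =
0` the logarithmic derivative in the `t` direction is `Ad_{c⁻¹} x`, and the one in the `w` direction
does not depend on `t`. One of the two derivative terms therefore vanishes. -/
theorem LevelExtension.fderiv_gAd_inv_const (ext : LevelExtension E G ip k K) {c : W → G}
    (hc : ContMDiff 𝓘(ℝ, W) 𝓘(ℝ, E) ∞ c) (x : E) (u v : W) :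
    fderiv ℝ (fun w => gAd (c w)⁻¹ x) u v
      = -gBracket G (logDeriv c u v) (gAd (c u)⁻¹ x) := by
  have := FiniteDimensional.complete ℝ E
  obtain ⟨b, hb, hb0, hbx⟩ :=
    exists_smooth_logDeriv_eq G (ContinuousLinearMap.toSpanSingleton ℝ x : ℝ →L[ℝ] E)
  have hb2 : ContMDiff 𝓘(ℝ, W × ℝ) 𝓘(ℝ, E) ∞ (fun z : W × ℝ => b z.2) :=
    hb.comp contDiff_snd.contMDiff
  have hc1 : ContMDiff 𝓘(ℝ, W × ℝ) 𝓘(ℝ, E) ∞ (fun z : W × ℝ => c z.1) :=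
    hc.comp contDiff_fst.contMDiff
  have hC : ContMDiff 𝓘(ℝ, W × ℝ) 𝓘(ℝ, E) ∞ (fun z : W × ℝ => b z.2 * c z.1) := hb2.mul hc1
  have hl : ∀ (z : W × ℝ) (y : W × ℝ), (logDeriv (fun z : W × ℝ => b z.2 * c z.1) z y : E)
      = gAd (c z.1)⁻¹ (logDeriv b z.2 y.2) + logDeriv c z.1 y.1 := by
    intro z y
    rw [logDeriv_mul (hb2.mdifferentiable (by simp) z) (hc1.mdifferentiable (by simp) z),
      logDeriv_comp (c := b) (f := fun z : W × ℝ => z.2) (hb.mdifferentiable (by simp) _)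
        differentiableAt_snd,
      logDeriv_comp (c := c) (f := fun z : W × ℝ => z.1) (hc.mdifferentiable (by simp) _)
        differentiableAt_fst, fderiv_fst, fderiv_snd]
    rfl
  have l0 : ∀ t, (logDeriv b t 0 : E) = 0 := fun t => (logDerivL b t).map_zero
  have l0' : ∀ t, (logDeriv c t 0 : E) = 0 := fun t => (logDerivL c t).map_zero
  have h := ext.maurerCartan_eq hC (u, 0) (v, 0) (0, 1)
  simp only [hl, l0, l0', gAd_zero, zero_add, add_zero, hbx,
    ContinuousLinearMap.toSpanSingleton_apply, one_smul] at h
  have hs : ContDiff ℝ ∞ (fun z : W × ℝ => gAd (c z.1)⁻¹ (logDeriv b z.2 1 : E)) :=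
    contDiff_gAd_inv hc1 ((contDiff_logDeriv_apply hb contDiff_const).comp contDiff_snd)
  have hs2 : ContDiff ℝ ∞ (fun w : W => (logDeriv c w v : E)) :=
    contDiff_logDeriv_apply hc contDiff_const
  have h1 : fderiv ℝ (fun z : W × ℝ => gAd (c z.1)⁻¹ (logDeriv b z.2 1 : E)) (u, 0) (v, 0)
      = fderiv ℝ (fun w => gAd (c w)⁻¹ x) u v := by
    have h2 := fderiv_comp (𝕜 := ℝ)
      (g := fun z : W × ℝ => gAd (c z.1)⁻¹ (logDeriv b z.2 1 : E)) (f := fun w : W => (w, (0 : ℝ)))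
      u (hs.differentiable (by simp) _) (by fun_prop)
    have h3 : (fun z : W × ℝ => gAd (c z.1)⁻¹ (logDeriv b z.2 1 : E)) ∘ (fun w : W => (w, (0 : ℝ)))
        = fun w => gAd (c w)⁻¹ x := by
      ext w
      simp [hbx]
    rw [h3] at h2
    rw [h2, ContinuousLinearMap.comp_apply]
    have h4 : fderiv ℝ (fun w : W => (w, (0 : ℝ))) u v = (v, 0) := by
      rw [(hasFDerivAt_prodMk_left u (0 : ℝ)).fderiv]
      simp
    rw [h4]
  have h2 : fderiv ℝ (fun z : W × ℝ => (logDeriv c z.1 v : E)) (u, 0) (0, 1) = 0 := by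
    have := fderiv_comp (𝕜 := ℝ) (g := fun w : W => (logDeriv c w v : E))
      (f := fun z : W × ℝ => z.1) (u, 0) (hs2.differentiable (by simp) _) differentiableAt_fst
    have h3 := DFunLike.congr_fun this (0, 1)
    rw [fderiv_fst, ContinuousLinearMap.comp_apply] at h3
    exact h3.trans (map_zero _)
  rw [h1, h2, sub_zero] at h
  exact eq_neg_of_add_eq_zero_left h

theorem LevelExtension.fderiv_gAd_inv (ext : LevelExtension E G ip k K) {c : W → G}
    (hc : ContMDiff 𝓘(ℝ, W) 𝓘(ℝ, E) ∞ c) {ξ : W → E} (hξ : ContDiff ℝ ∞ ξ) (u v : W) :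
    fderiv ℝ (fun w => gAd (c w)⁻¹ (ξ w)) u v
      = gAd (c u)⁻¹ (fderiv ℝ ξ u v) - gBracket G (logDeriv c u v) (gAd (c u)⁻¹ (ξ u)) := by
  have h1 := fderiv_clm_apply (((contDiff_gAdL hc.inv).differentiable (by simp)) u)
    (hξ.differentiable (by simp) u)
  have h2 := fderiv_clm_apply (((contDiff_gAdL hc.inv).differentiable (by simp)) u)
    (differentiableAt_const (𝕜 := ℝ) (ξ u))
  have h3 := DFunLike.congr_fun h1 v
  have h4 := DFunLike.congr_fun h2 v
  simp only [gAdL_apply, fderiv_fun_const, add_apply,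
    ContinuousLinearMap.comp_apply, ContinuousLinearMap.flip_apply, Pi.zero_apply,
    zero_apply, gAd_zero, zero_add] at h3 h4
  rw [ext.fderiv_gAd_inv_const hc] at h4
  rw [h3, ← h4]
  abel

/-- Right translation by `g⁻¹` changes logarithmic derivatives by the constant linear map `Ad_g`.
Comparing the Maurer-Cartan equations of `b` and `b g⁻¹`, with `b` leaving `1` in the directions `x`
and `y`, gives the claim. -/
theorem LevelExtension.gAd_gBracket (ext : LevelExtension E G ip k K) (g : G) (x y : E) :
    gAd g (gBracket G x y) = gBracket G (gAd g x) (gAd g y) := by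
  have := FiniteDimensional.complete ℝ E
  obtain ⟨b, hb, hb0, hbx⟩ := exists_smooth_logDeriv_eq G
    ((ContinuousLinearMap.fst ℝ ℝ ℝ).smulRight x + (ContinuousLinearMap.snd ℝ ℝ ℝ).smulRight y)
  have hc : ContMDiff 𝓘(ℝ, ℝ × ℝ) 𝓘(ℝ, E) ∞ (fun z => b z * g⁻¹) := hb.mul contMDiff_const
  have hl : ∀ z v, (logDeriv (fun z => b z * g⁻¹) z v : E) = gAd g (logDeriv b z v) := by
    intro z v
    rw [logDeriv_mul (hb.mdifferentiable (by simp) z) mdifferentiableAt_const, logDeriv_const,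
      inv_inv, add_zero]
  have hd : ∀ v w : ℝ × ℝ, fderiv ℝ (fun z => gAd g (logDeriv b z v : E)) 0 w
      = gAd g (fderiv ℝ (fun z => (logDeriv b z v : E)) 0 w) := by
    intro v w
    have hs : ContDiff ℝ ∞ (fun w => (logDeriv b w v : E)) :=
      contDiff_logDeriv_apply hb contDiff_const
    exact DFunLike.congr_fun
      ((gAdL g : E →L[ℝ] E).hasFDerivAt.comp 0 (hs.differentiable (by simp) 0).hasFDerivAt).fderiv w
  have h1 := ext.maurerCartan_eq hb 0 (1, 0) (0, 1)
  have h2 := ext.maurerCartan_eq hc 0 (1, 0) (0, 1)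
  simp only [hl, hd] at h2
  replace h1 := congrArg (gAd g) h1
  rw [gAd_add, gAd_sub, gAd_zero, ← h2] at h1
  simpa [hbx] using h1

/-- Differentiate the invariance of `ip` under `Ad_{b(t)⁻¹}` at `t = 0`, along a curve `b` leaving
`1` with velocity `a`. -/
theorem LevelExtension.ip_gBracket (ext : LevelExtension E G ip k K)
    (ip_inv : ∀ (g : G) (x y : E), ip (gAd g x) (gAd g y) = ip x y) (a x y : E) :
    ip (gBracket G a x) y + ip x (gBracket G a y) = 0 := by
  obtain ⟨b, hb, hb0, hbx⟩ :=
    exists_smooth_logDeriv_eq G (ContinuousLinearMap.toSpanSingleton ℝ a : ℝ →L[ℝ] E)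
  have hx : ∀ z : E, DifferentiableAt ℝ (fun t : ℝ => gAd (b t)⁻¹ z) 0 := fun z =>
    (contDiff_gAd_inv hb contDiff_const).differentiable (by simp) 0
  have h1 := fderiv_bilin ip (hx x) (hx y) 1
  simp only [ip_inv, ext.fderiv_gAd_inv_const hb, hb0, inv_one, gAd_one, hbx,
    ContinuousLinearMap.toSpanSingleton_apply, one_smul, map_neg, LinearMap.neg_apply,
    fderiv_fun_const, Pi.zero_apply, zero_apply] at h1
  linarith

end MaurerCartan

/-! ### Smooth dependence of integrals on parameters -/

section ParametricIntegral

variable {n : ℕ}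

theorem hasFDerivAt_parametric_intervalIntegral {F : Euc n × ℝ → ℝ} (hF : ContDiff ℝ ∞ F)
    (u : Euc n) : HasFDerivAt (fun w => ∫ t in (0 : ℝ)..1, F (w, t))
      (∫ t in (0 : ℝ)..1, (fderiv ℝ F (u, t)).comp (ContinuousLinearMap.inl ℝ (Euc n) ℝ)) u := by
  have hF' : Continuous (fun z => (fderiv ℝ F z).comp (ContinuousLinearMap.inl ℝ (Euc n) ℝ)) :=
    (hF.continuous_fderiv (by simp)).clm_comp continuous_const
  -- Compactness gives a constant bound on the partial derivative, which serves as the dominating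
  -- function.
  have hc : IsCompact (Metric.closedBall u 1 ×ˢ Set.Icc (0 : ℝ) 1) :=
    (isCompact_closedBall u 1).prod isCompact_Icc
  obtain ⟨C, hC⟩ := (hc.image hF').isBounded.exists_norm_le
  refine intervalIntegral.hasFDerivAt_integral_of_dominated_of_fderiv_le (bound := fun _ => C)
    (s := Metric.closedBall u 1)
    (F := fun w t => F (w, t))
    (F' := fun w t => (fderiv ℝ F (w, t)).comp (ContinuousLinearMap.inl ℝ (Euc n) ℝ))
    (Metric.closedBall_mem_nhds _ one_pos) ?_ ?_ ?_ ?_ ?_ ?_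
  · exact Filter.Eventually.of_forall fun w =>
      (hF.continuous.comp (by fun_prop : Continuous fun t : ℝ => (w, t))).aestronglyMeasurable
  · exact (hF.continuous.comp
      (by fun_prop : Continuous fun t : ℝ => (u, t))).intervalIntegrable _ _
  · exact (hF'.comp (by fun_prop : Continuous fun t : ℝ => (u, t))).aestronglyMeasurable
  · refine Filter.Eventually.of_forall fun t ht w hw => hC _ ⟨(w, t), ⟨hw, ?_⟩, rfl⟩
    rw [Set.uIoc_of_le zero_le_one] at ht
    exact Set.Ioc_subset_Icc_self ht
  · exact intervalIntegrable_const
  · refine Filter.Eventually.of_forall fun t _ w _ => ?_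
    exact (hF.differentiable (by simp) (w, t)).hasFDerivAt.comp w (hasFDerivAt_prodMk_left w t)

theorem fderiv_parametric_intervalIntegral {F : Euc n × ℝ → ℝ} (hF : ContDiff ℝ ∞ F)
    (u v : Euc n) : fderiv ℝ (fun w => ∫ t in (0 : ℝ)..1, F (w, t)) u v
      = ∫ t in (0 : ℝ)..1, fderiv ℝ F (u, t) (v, 0) := by
  have hF' : Continuous (fun z => (fderiv ℝ F z).comp (ContinuousLinearMap.inl ℝ (Euc n) ℝ)) :=
    (hF.continuous_fderiv (by simp)).clm_comp continuous_const
  have hi : IntervalIntegrable (fun t => (fderiv ℝ F (u, t)).comp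
      (ContinuousLinearMap.inl ℝ (Euc n) ℝ)) volume 0 1 :=
    (hF'.comp (by fun_prop : Continuous fun t : ℝ => (u, t))).intervalIntegrable _ _
  rw [(hasFDerivAt_parametric_intervalIntegral hF u).fderiv,
    ContinuousLinearMap.intervalIntegral_apply hi]
  rfl

/-- Each directional derivative is again an integral of the same kind, with a partial derivative as
new integrand; hence the induction runs over all `F` at once. -/
theorem contDiff_parametric_intervalIntegral {F : Euc n × ℝ → ℝ} (hF : ContDiff ℝ ∞ F) :
    ContDiff ℝ ∞ (fun w => ∫ t in (0 : ℝ)..1, F (w, t)) := by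
  rw [contDiff_infty]
  intro m
  induction m generalizing F with
  | zero =>
    rw [Nat.cast_zero, contDiff_zero]
    exact (show Differentiable ℝ _ from fun u =>
      (hasFDerivAt_parametric_intervalIntegral hF u).differentiableAt).continuous
  | succ m ih =>
    rw [Nat.cast_add, Nat.cast_one, contDiff_succ_iff_fderiv_apply]
    refine ⟨fun u => (hasFDerivAt_parametric_intervalIntegral hF u).differentiableAt,
      fun h => by simp at h, fun v => ?_⟩
    simp only [fderiv_parametric_intervalIntegral hF]
    exact ih (F := fun z => fderiv ℝ F z (v, 0))
      ((hF.fderiv_right (m := ∞) (by simp)).clm_apply contDiff_const)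

end ParametricIntegral

/-! ### Calculus of loops and the pairing on the circle -/

section Loops

variable {F : Type*} [NormedAddCommGroup F] [NormedSpace ℝ F]
variable {E : Type*} [NormedAddCommGroup E] [NormedSpace ℝ E]

/-- Smooth loops in a normed space. -/
def LoopSmooth (ξ : UnitAddCircle → F) : Prop := ContDiff ℝ ∞ (fun t : ℝ => ξ (t : UnitAddCircle))

theorem exists_coe_eq (θ : UnitAddCircle) : ∃ t : ℝ, (t : UnitAddCircle) = θ :=
  QuotientAddGroup.mk_surjective θ

theorem loopDeriv_coe (ξ : UnitAddCircle → F) (t : ℝ) :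
    loopDeriv ξ (t : UnitAddCircle) = deriv (fun s : ℝ => ξ (s : UnitAddCircle)) t := by
  unfold loopDeriv
  simp only [← AddCircle.coe_add]
  rw [deriv_comp_const_add (f := fun s : ℝ => ξ (s : UnitAddCircle)), add_zero]

theorem LoopSmooth.continuous {ξ : UnitAddCircle → F} (h : LoopSmooth ξ) : Continuous ξ :=
  continuous_coinduced_dom.2 (ContDiff.continuous h)

theorem LoopSmooth.loopDeriv {ξ : UnitAddCircle → F} (h : LoopSmooth ξ) :
    LoopSmooth (loopDeriv ξ) := by
  unfold LoopSmooth
  simp only [loopDeriv_coe]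
  exact ((contDiff_infty_iff_deriv.1 h).2)

theorem LoopSmooth.differentiableAt {ξ : UnitAddCircle → F} (h : LoopSmooth ξ) (t : ℝ) :
    DifferentiableAt ℝ (fun s : ℝ => ξ (s : UnitAddCircle)) t :=
  ContDiff.differentiable h (by simp) t

theorem integral_circle (f : UnitAddCircle → F) :
    ∫ θ : UnitAddCircle, f θ = ∫ t in (0 : ℝ)..1, f (t : UnitAddCircle) := by
  rw [← UnitAddCircle.intervalIntegral_preimage 0 f, zero_add]

/-- The fundamental theorem of calculus on `[0, 1]`, whose endpoints are the same point of the
circle. -/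
theorem integral_loopDeriv {f : UnitAddCircle → ℝ} (h : LoopSmooth f) :
    ∫ θ : UnitAddCircle, loopDeriv f θ = 0 := by
  rw [integral_circle]
  simp only [loopDeriv_coe]
  rw [intervalIntegral.integral_deriv_eq_sub' (fun s : ℝ => f (s : UnitAddCircle)) rfl
    (fun t _ => h.differentiableAt t) ((contDiff_infty_iff_deriv.1 h).2.continuous.continuousOn)]
  rw [AddCircle.coe_period, AddCircle.coe_zero, sub_self]

variable [FiniteDimensional ℝ E]

theorem LoopSmooth.bilin (B : E →ₗ[ℝ] E →ₗ[ℝ] F) {ξ η : UnitAddCircle → E} (hξ : LoopSmooth ξ)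
    (hη : LoopSmooth η) : LoopSmooth (fun θ => B (ξ θ) (η θ)) :=
  contDiff_bilin B hξ hη

theorem loopDeriv_bilin (B : E →ₗ[ℝ] E →ₗ[ℝ] F) {ξ η : UnitAddCircle → E} (hξ : LoopSmooth ξ)
    (hη : LoopSmooth η) (θ : UnitAddCircle) : loopDeriv (fun θ => B (ξ θ) (η θ)) θ
      = B (loopDeriv ξ θ) (η θ) + B (ξ θ) (loopDeriv η θ) := by
  obtain ⟨t, rfl⟩ := exists_coe_eq θ
  simp only [loopDeriv_coe, ← fderiv_apply_one_eq_deriv]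
  exact fderiv_bilin B (hξ.differentiableAt t) (hη.differentiableAt t) 1

theorem loopDeriv_add {ξ η : UnitAddCircle → E} (hξ : LoopSmooth ξ)
    (hη : LoopSmooth η) : loopDeriv (ξ + η) = loopDeriv ξ + loopDeriv η := by
  ext θ
  obtain ⟨t, rfl⟩ := exists_coe_eq θ
  simp only [loopDeriv_coe, Pi.add_apply]
  exact deriv_add (hξ.differentiableAt t) (hη.differentiableAt t)

theorem loopDeriv_smul (r : ℝ) (ξ : UnitAddCircle → E) :
    loopDeriv (r • ξ) = r • loopDeriv ξ := by
  ext θ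
  exact deriv_const_smul_field r (fun t : ℝ => ξ (θ + (t : UnitAddCircle)))

theorem LoopSmooth.add {ξ η : UnitAddCircle → E} (hξ : LoopSmooth ξ) (hη : LoopSmooth η) :
    LoopSmooth (ξ + η) := ContDiff.add hξ hη

theorem LoopSmooth.sub {ξ η : UnitAddCircle → E} (hξ : LoopSmooth ξ) (hη : LoopSmooth η) :
    LoopSmooth (ξ - η) := ContDiff.sub hξ hη

theorem LoopSmooth.neg {ξ : UnitAddCircle → E} (hξ : LoopSmooth ξ) :
    LoopSmooth (-ξ) := ContDiff.neg hξ

theorem LoopSmooth.smul (r : ℝ) {ξ : UnitAddCircle → E} (hξ : LoopSmooth ξ) :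
    LoopSmooth (r • ξ) := ContDiff.const_smul r hξ

variable (ip : LinearMap.BilinForm ℝ E)

theorem LoopSmooth.integrable_pair {ξ η : UnitAddCircle → E} (hξ : LoopSmooth ξ)
    (hη : LoopSmooth η) : Integrable (fun θ => ip (ξ θ) (η θ)) :=
  (hξ.bilin ip hη).continuous.integrable_of_hasCompactSupport (HasCompactSupport.of_compactSpace _)

/-- Smoothness supplies integrability, without which the integral need not be additive. The scalar
and sign rules below hold for arbitrary functions. -/
theorem loopPair_add_left {ξ ζ η : UnitAddCircle → E} (hξ : LoopSmooth ξ) (hζ : LoopSmooth ζ)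
    (hη : LoopSmooth η) : loopPair ip (ξ + ζ) η = loopPair ip ξ η + loopPair ip ζ η := by
  unfold loopPair
  rw [← integral_add (hξ.integrable_pair ip hη) (hζ.integrable_pair ip hη)]
  simp

theorem loopPair_smul_left (r : ℝ) (ξ η : UnitAddCircle → E) :
    loopPair ip (r • ξ) η = r * loopPair ip ξ η := by
  unfold loopPair
  rw [← integral_const_mul]
  simp

theorem loopPair_neg_left (ξ η : UnitAddCircle → E) :
    loopPair ip (-ξ) η = -loopPair ip ξ η := by
  unfold loopPair
  rw [← integral_neg]
  simp

theorem loopPair_symm {ip : LinearMap.BilinForm ℝ E} (ip_symm : ∀ x y, ip x y = ip y x)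
    (ξ η : UnitAddCircle → E) : loopPair ip ξ η = loopPair ip η ξ := by
  unfold loopPair
  simp only [ip_symm]

theorem loopPair_shift (ξ η : UnitAddCircle → E) (a : UnitAddCircle) :
    loopPair ip (fun θ => ξ (θ + a)) (fun θ => η (θ + a)) = loopPair ip ξ η :=
  integral_add_right_eq_self (fun θ => ip (ξ θ) (η θ)) a

/-- Integration by parts; a closed loop has no boundary term. -/
theorem loopPair_loopDeriv {ξ η : UnitAddCircle → E} (hξ : LoopSmooth ξ) (hη : LoopSmooth η) :
    loopPair ip ξ (loopDeriv η) = -loopPair ip (loopDeriv ξ) η := by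
  have h := integral_loopDeriv (hξ.bilin ip hη)
  simp only [loopDeriv_bilin ip hξ hη] at h
  rw [integral_add (hξ.loopDeriv.integrable_pair ip hη) (hξ.integrable_pair ip hη.loopDeriv)] at h
  unfold loopPair
  linarith

theorem loopDeriv_shift (ξ : UnitAddCircle → E) (a : UnitAddCircle) :
    loopDeriv (fun θ => ξ (θ + a)) = fun θ => loopDeriv ξ (θ + a) := by
  ext θ
  unfold loopDeriv
  simp only [add_right_comm]

end Loops

/-! ### Smooth families of loops -/

section Families

variable {F : Type*} [NormedAddCommGroup F] [NormedSpace ℝ F]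
variable {E : Type*} [NormedAddCommGroup E] [NormedSpace ℝ E] {n : ℕ}

/-- The derivative of a family of loops in the parameter. -/
def dLoop (ξ : Euc n → UnitAddCircle → E) (u v : Euc n) : UnitAddCircle → E :=
  fun θ => fderiv ℝ (fun u' => ξ u' θ) u v

variable {ξ η : Euc n → UnitAddCircle → E}

theorem SmoothLoop.loopSmooth (h : SmoothLoop ξ) (u : Euc n) : LoopSmooth (ξ u) :=
  ContDiff.comp (g := fun z : Euc n × ℝ => ξ z.1 (z.2 : UnitAddCircle)) h
    (by fun_prop : ContDiff ℝ ∞ (fun t : ℝ => (u, t)))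

theorem SmoothLoop.contDiff (h : SmoothLoop ξ) (θ : UnitAddCircle) :
    ContDiff ℝ ∞ (fun u => ξ u θ) := by
  obtain ⟨t, rfl⟩ := exists_coe_eq θ
  exact ContDiff.comp (g := fun z : Euc n × ℝ => ξ z.1 (z.2 : UnitAddCircle)) h
    (by fun_prop : ContDiff ℝ ∞ (fun u : Euc n => (u, t)))

theorem SmoothLoop.differentiableAt (h : SmoothLoop ξ) (θ : UnitAddCircle) (u : Euc n) :
    DifferentiableAt ℝ (fun u => ξ u θ) u := (h.contDiff θ).differentiable (by simp) u

theorem SmoothLoop.hasFDerivAt (h : SmoothLoop ξ) (z : Euc n × ℝ) :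
    HasFDerivAt (fun z : Euc n × ℝ => ξ z.1 (z.2 : UnitAddCircle))
      (fderiv ℝ (fun z : Euc n × ℝ => ξ z.1 (z.2 : UnitAddCircle)) z) z :=
  (ContDiff.differentiable h (by simp) z).hasFDerivAt

theorem SmoothLoop.dLoop_coe (h : SmoothLoop ξ) (u v : Euc n) (t : ℝ) :
    dLoop ξ u v (t : UnitAddCircle)
      = fderiv ℝ (fun z : Euc n × ℝ => ξ z.1 (z.2 : UnitAddCircle)) (u, t) (v, 0) := by
  have h0 : HasFDerivAt (fun u : Euc n => (u, t)) (ContinuousLinearMap.inl ℝ (Euc n) ℝ) u :=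
    hasFDerivAt_prodMk_left u t
  have h1 := HasFDerivAt.comp (𝕜 := ℝ) u (h.hasFDerivAt (u, t)) h0
  exact DFunLike.congr_fun h1.fderiv v

theorem SmoothLoop.loopDeriv_coe (h : SmoothLoop ξ) (u : Euc n) (t : ℝ) :
    loopDeriv (ξ u) (t : UnitAddCircle)
      = fderiv ℝ (fun z : Euc n × ℝ => ξ z.1 (z.2 : UnitAddCircle)) (u, t) (0, 1) := by
  have h1 := (SmoothLoop.hasFDerivAt h (u, t)).comp t
    (hasFDerivAt_prodMk_right u t)
  rw [LoopLift.loopDeriv_coe, ← fderiv_apply_one_eq_deriv]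
  exact DFunLike.congr_fun h1.fderiv 1

theorem SmoothLoop.dLoop (h : SmoothLoop ξ) (v : Euc n) : SmoothLoop (fun u => dLoop ξ u v) := by
  unfold SmoothLoop
  simp only [h.dLoop_coe]
  exact (ContDiff.fderiv_right (m := ∞) h (by simp)).clm_apply contDiff_const

theorem SmoothLoop.loopDeriv (h : SmoothLoop ξ) : SmoothLoop (fun u => loopDeriv (ξ u)) := by
  unfold SmoothLoop
  simp only [h.loopDeriv_coe]
  exact (ContDiff.fderiv_right (m := ∞) h (by simp)).clm_apply contDiff_const

theorem SmoothLoop.add (hξ : SmoothLoop ξ) (hη : SmoothLoop η) :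
    SmoothLoop (fun u => ξ u + η u) := ContDiff.add hξ hη

theorem SmoothLoop.sub (hξ : SmoothLoop ξ) (hη : SmoothLoop η) :
    SmoothLoop (fun u => ξ u - η u) := ContDiff.sub hξ hη

theorem SmoothLoop.smul {c : Euc n → ℝ} (hc : ContDiff ℝ ∞ c) (hξ : SmoothLoop ξ) :
    SmoothLoop (fun u => c u • ξ u) :=
  ContDiff.smul (hc.comp contDiff_fst) hξ

theorem SmoothLoop.shift {c : Euc n → ℝ} (hc : ContDiff ℝ ∞ c) (hξ : SmoothLoop ξ) :
    SmoothLoop (fun u θ => ξ u (θ - (c u : UnitAddCircle))) := by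
  have h : ContDiff ℝ ∞ (fun z : Euc n × ℝ => (z.1, z.2 - c z.1)) := by fun_prop
  exact ContDiff.comp (g := fun z : Euc n × ℝ => ξ z.1 (z.2 : UnitAddCircle)) hξ h

/-- Chain rule along `u ↦ (u, t - c u)`. The correction by the loop derivative later becomes the
circle part of the affine bracket. -/
theorem dLoop_shift {c : Euc n → ℝ} (hc : ContDiff ℝ ∞ c) (hξ : SmoothLoop ξ) (u v : Euc n)
    (θ : UnitAddCircle) : LoopLift.dLoop (fun u θ => ξ u (θ - (c u : UnitAddCircle))) u v θ
      = LoopLift.dLoop ξ u v (θ - (c u : UnitAddCircle))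
        - fderiv ℝ c u v • LoopLift.loopDeriv (ξ u) (θ - (c u : UnitAddCircle)) := by
  obtain ⟨t, rfl⟩ := exists_coe_eq θ
  rw [← AddCircle.coe_sub, hξ.dLoop_coe, hξ.loopDeriv_coe]
  have hcu : HasFDerivAt c (fderiv ℝ c u) u := (hc.differentiable (by simp) u).hasFDerivAt
  have h1 : HasFDerivAt (fun u : Euc n => (u, t - c u))
      ((ContinuousLinearMap.id ℝ (Euc n)).prod (-fderiv ℝ c u)) u :=
    (hasFDerivAt_id u).prodMk (hcu.const_sub t)
  have h2 := (SmoothLoop.hasFDerivAt hξ (u, t - c u)).comp u h1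
  refine (DFunLike.congr_fun h2.fderiv v).trans ?_
  have h3 : ((v, -fderiv ℝ c u v) : Euc n × ℝ) = (v, 0) - fderiv ℝ c u v • ((0 : Euc n), (1 : ℝ)) := by
    simp
  rw [← map_smul, ← map_sub, ← h3]
  rfl

variable [FiniteDimensional ℝ E]

theorem SmoothLoop.bilin (B : E →ₗ[ℝ] E →ₗ[ℝ] F) (hξ : SmoothLoop ξ)
    (hη : SmoothLoop η) : SmoothLoop (fun u θ => B (ξ u θ) (η u θ)) :=
  contDiff_bilin B hξ hη

variable (ip : LinearMap.BilinForm ℝ E)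

theorem SmoothLoop.contDiff_loopPair (hξ : SmoothLoop ξ) (hη : SmoothLoop η) :
    ContDiff ℝ ∞ (fun u => loopPair ip (ξ u) (η u)) := by
  unfold loopPair
  simp only [integral_circle]
  exact contDiff_parametric_intervalIntegral
    (F := fun z => ip (ξ z.1 (z.2 : UnitAddCircle)) (η z.1 (z.2 : UnitAddCircle))) (hξ.bilin ip hη)

theorem fderiv_loopPair (hξ : SmoothLoop ξ) (hη : SmoothLoop η) (u v : Euc n) :
    fderiv ℝ (fun u => loopPair ip (ξ u) (η u)) u v
      = loopPair ip (dLoop ξ u v) (η u) + loopPair ip (ξ u) (dLoop η u v) := by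
  have h1 := fderiv_parametric_intervalIntegral
    (F := fun z => ip (ξ z.1 (z.2 : UnitAddCircle)) (η z.1 (z.2 : UnitAddCircle))) (hξ.bilin ip hη)
    u v
  simp only [← (hξ.bilin ip hη).dLoop_coe] at h1
  rw [← integral_circle] at h1
  have h2 : ∀ θ, dLoop (fun u θ => ip (ξ u θ) (η u θ)) u v θ
      = ip (dLoop ξ u v θ) (η u θ) + ip (ξ u θ) (dLoop η u v θ) := fun θ =>
    fderiv_bilin ip (hξ.differentiableAt θ u) (hη.differentiableAt θ u) v
  simp only [h2] at h1
  rw [integral_add (((hξ.dLoop v).loopSmooth u).integrable_pair ip (hη.loopSmooth u))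
    ((hξ.loopSmooth u).integrable_pair ip ((hη.dLoop v).loopSmooth u))] at h1
  have h3 : (fun u => loopPair ip (ξ u) (η u)) = fun w => ∫ t in (0 : ℝ)..1,
      ip (ξ w (t : UnitAddCircle)) (η w (t : UnitAddCircle)) :=
    funext fun u => integral_circle _
  rw [h3]
  exact h1

end Families

/-! ### The adjoint action of an inverse: pointwise twist, then rotation -/

section Twist

variable {E : Type*} [NormedAddCommGroup E] [NormedSpace ℝ E] {G : Type*}
    [TopologicalSpace G] [ChartedSpace E G] [Group G] [LieGroup 𝓘(ℝ, E) ∞ G]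

theorem LoopRot.contMDiff_loop (g : LoopRot E G) :
    ContMDiff 𝓘(ℝ, ℝ) 𝓘(ℝ, E) ∞ (fun t : ℝ => g.loop (t : UnitAddCircle)) := g.left.2

theorem LoopRot.angle_inv (g : LoopRot E G) : (g⁻¹).angle = -g.angle := rfl

theorem LoopRot.loop_inv (g : LoopRot E G) (θ : UnitAddCircle) :
    (g⁻¹).loop θ = (g.loop (θ + -g.angle))⁻¹ := rfl

theorem logDeriv_loop_coe (g : LoopRot E G) (t : ℝ) :
    loopLog g (t : UnitAddCircle) = logDeriv (fun s : ℝ => g.loop (s : UnitAddCircle)) t 1 := by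
  unfold loopLog
  simp only [← AddCircle.coe_add]
  rw [logDeriv_comp (c := fun s : ℝ => g.loop (s : UnitAddCircle)) (f := fun s => t + s)
    (g.contMDiff_loop.mdifferentiable (by simp) _) (by fun_prop), fderiv_const_add]
  simp

theorem loopLog_inv (g : LoopRot E G) (θ : UnitAddCircle) :
    loopLog g⁻¹ θ = -gAd (g.loop (θ + -g.angle)) (loopLog g (θ + -g.angle)) := by
  obtain ⟨t, ht⟩ := exists_coe_eq (θ + -g.angle)
  have h1 : loopLog g⁻¹ θ
      = logDeriv (fun s : ℝ => (g.loop (θ + -g.angle + (s : UnitAddCircle)))⁻¹) 0 1 := by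
    unfold loopLog
    simp only [LoopRot.loop_inv, add_right_comm]
  have h2 : MDifferentiableAt 𝓘(ℝ, ℝ) 𝓘(ℝ, E)
      (fun s : ℝ => g.loop (θ + -g.angle + (s : UnitAddCircle))) 0 := by
    simp only [← ht, ← AddCircle.coe_add]
    have h3 : ContDiff ℝ ∞ (fun s : ℝ => t + s) := by fun_prop
    exact (g.contMDiff_loop.comp h3.contMDiff).mdifferentiable (by simp) 0
  rw [h1, logDeriv_inv h2, AddCircle.coe_zero, add_zero]
  rfl

/-- The pointwise action `Ad_{γ⁻¹}` of the loop of `g`. -/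
def twist (g : LoopRot E G) (ξ : UnitAddCircle → E) : UnitAddCircle → E :=
  fun θ => gAd (g.loop θ)⁻¹ (ξ θ)

theorem twist_add (g : LoopRot E G) (ξ η : UnitAddCircle → E) :
    twist g (ξ + η) = twist g ξ + twist g η := funext fun _ => gAd_add _ _ _

theorem twist_sub (g : LoopRot E G) (ξ η : UnitAddCircle → E) :
    twist g (ξ - η) = twist g ξ - twist g η := funext fun _ => gAd_sub _ _ _

theorem twist_neg (g : LoopRot E G) (ξ : UnitAddCircle → E) :
    twist g (-ξ) = -twist g ξ := funext fun _ => gAd_neg _ _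

theorem twist_smul (g : LoopRot E G) (r : ℝ) (ξ : UnitAddCircle → E) :
    twist g (r • ξ) = r • twist g ξ := funext fun _ => gAd_smul _ _ _

theorem loopSmooth_loopLog (g : LoopRot E G) : LoopSmooth (loopLog g) := by
  unfold LoopSmooth
  simp only [logDeriv_loop_coe]
  exact (contDiff_logDeriv g.contMDiff_loop).clm_apply contDiff_const

theorem LoopSmooth.twist (g : LoopRot E G) {ξ : UnitAddCircle → E} (hξ : LoopSmooth ξ) :
    LoopSmooth (twist g ξ) :=
  (contDiff_gAdL g.contMDiff_loop.inv).clm_apply hξ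

/-- Translation of the loop component. -/
def shiftAff (a : UnitAddCircle) (X : AffAlg E) : AffAlg E := (X.1, fun θ => X.2.1 (θ + a), X.2.2)

/-- The adjoint action of `γ⁻¹`, where `γ` is the loop of `g`. -/
def twistAff (ip : LinearMap.BilinForm ℝ E) (k : ℤ) (g : LoopRot E G) (X : AffAlg E) : AffAlg E :=
  (X.1, twist g X.2.1 + X.1 • loopLog g,
    X.2.2 + k * loopPair ip (loopLog g) (twist g X.2.1)
      + (k / 2 : ℝ) * X.1 * loopPair ip (loopLog g) (loopLog g))

theorem rotAd_inv (g : LoopRot E G) (X : RotAlg E) : rotAd g⁻¹ X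
    = (X.1, fun θ => (twist g X.2 + X.1 • loopLog g) (θ + -g.angle)) := by
  refine Prod.ext rfl (funext fun θ => ?_)
  simp only [rotAd, LoopRot.angle_inv, loopLog_inv, LoopRot.loop_inv, gAd_neg, gAd_inv_gAd,
    smul_neg, sub_neg_eq_add]
  rfl

/-- Separates the rotation, which all structures respect, from the action of the loop. The
logarithmic derivative of the inverse is `-Ad_γ (γ⁻¹γ')` up to rotation, so invariance of `ip` and
of the measure on the circle turns the central terms into those of `twistAff`. -/
theorem affAd_inv [FiniteDimensional ℝ E] {ip : LinearMap.BilinForm ℝ E}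
    (ip_inv : ∀ (g : G) (x y : E), ip (gAd g x) (gAd g y) = ip x y) (k : ℤ)
    (g : LoopRot E G) (X : AffAlg E) :
    affAd ip k g⁻¹ X = shiftAff (-g.angle) (twistAff ip k g X) := by
  have h1 : loopPair ip (loopLog g⁻¹) (fun θ => X.2.1 (θ + (g⁻¹).angle))
      = -loopPair ip (loopLog g) (twist g X.2.1) := by
    rw [← loopPair_shift ip (loopLog g) _ (-g.angle), ← loopPair_neg_left]
    unfold loopPair
    refine integral_congr_ae (Filter.Eventually.of_forall fun θ => ?_)
    simp only [loopLog_inv, LoopRot.angle_inv, twist, Pi.neg_apply, map_neg, LinearMap.neg_apply]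
    rw [← ip_inv (g.loop (θ + -g.angle)) (loopLog g _), gAd_gAd_inv]
  have h2 : loopPair ip (loopLog g⁻¹) (loopLog g⁻¹) = loopPair ip (loopLog g) (loopLog g) := by
    rw [← loopPair_shift ip (loopLog g) _ (-g.angle)]
    unfold loopPair
    refine integral_congr_ae (Filter.Eventually.of_forall fun θ => ?_)
    simp only [loopLog_inv, map_neg, LinearMap.neg_apply, neg_neg, ip_inv]
  unfold affAd
  rw [rotAd_inv, h1, h2]
  simp [shiftAff, twistAff, proj]

end Twist

/-! ### Invariance of the affine bracket and pairing -/

section Bracket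

variable {E : Type*} [NormedAddCommGroup E] [NormedSpace ℝ E] {G : Type*}
    [TopologicalSpace G] [ChartedSpace E G] [Group G] [LieGroup 𝓘(ℝ, E) ∞ G]

variable (G) in
/-- The pointwise bracket of loops. -/
def loopBracket (ξ η : UnitAddCircle → E) : UnitAddCircle → E :=
  fun θ => gBracket G (ξ θ) (η θ)

variable (G) in
theorem affBracket_eq (ip : LinearMap.BilinForm ℝ E) (k : ℤ) (X Y : AffAlg E) :
    affBracket G ip k X Y = (0, loopBracket G X.2.1 Y.2.1 + X.1 • loopDeriv Y.2.1
      - Y.1 • loopDeriv X.2.1, k * loopPair ip X.2.1 (loopDeriv Y.2.1)) := rfl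

variable [FiniteDimensional ℝ E]

variable (G) in
theorem loopBracket_add_left (ξ ζ η : UnitAddCircle → E) :
    loopBracket G (ξ + ζ) η = loopBracket G ξ η + loopBracket G ζ η :=
  have := FiniteDimensional.complete ℝ E
  funext fun _ => gBracket_add_left G _ _ _

variable (G) in
theorem loopBracket_add_right (ξ ζ η : UnitAddCircle → E) :
    loopBracket G ξ (ζ + η) = loopBracket G ξ ζ + loopBracket G ξ η :=
  have := FiniteDimensional.complete ℝ E
  funext fun _ => gBracket_add_right G _ _ _

variable (G) in
theorem loopBracket_smul_right (r : ℝ) (ξ η : UnitAddCircle → E) :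
    loopBracket G ξ (r • η) = r • loopBracket G ξ η :=
  have := FiniteDimensional.complete ℝ E
  funext fun _ => gBracket_smul_right G _ _ _

variable (G) in
theorem loopBracket_skew (ξ η : UnitAddCircle → E) :
    loopBracket G ξ η = -loopBracket G η ξ :=
  have := FiniteDimensional.complete ℝ E
  funext fun _ => gBracket_skew G _ _

variable (G) in
theorem loopBracket_self (ξ : UnitAddCircle → E) : loopBracket G ξ ξ = 0 :=
  have := FiniteDimensional.complete ℝ E
  funext fun _ => gBracket_self G _

variable (G) in
theorem loopBracket_smul_left (r : ℝ) (ξ η : UnitAddCircle → E) :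
    loopBracket G (r • ξ) η = r • loopBracket G ξ η := by
  rw [loopBracket_skew, loopBracket_smul_right, loopBracket_skew G η, smul_neg, neg_neg]

variable (G) in
theorem LoopSmooth.loopBracket {ξ η : UnitAddCircle → E} (hξ : LoopSmooth ξ)
    (hη : LoopSmooth η) : LoopSmooth (loopBracket G ξ η) :=
  have := FiniteDimensional.complete ℝ E
  hξ.bilin (gBracketL G) hη

variable (ip : LinearMap.BilinForm ℝ E) (k : ℤ)

theorem affBracket_shift (a : UnitAddCircle) (X Y : AffAlg E) :
    affBracket G ip k (shiftAff a X) (shiftAff a Y) = shiftAff a (affBracket G ip k X Y) := by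
  simp only [affBracket_eq, shiftAff, loopDeriv_shift, loopPair_shift]
  rfl

variable {ip}

theorem loopPair_add_right (ip_symm : ∀ x y, ip x y = ip y x) {ξ ζ η : UnitAddCircle → E}
    (hξ : LoopSmooth ξ) (hζ : LoopSmooth ζ)
    (hη : LoopSmooth η) : loopPair ip ξ (ζ + η) = loopPair ip ξ ζ + loopPair ip ξ η := by
  rw [loopPair_symm ip_symm, loopPair_add_left ip hζ hη hξ, loopPair_symm ip_symm ζ,
    loopPair_symm ip_symm η]

theorem loopPair_neg_right (ip_symm : ∀ x y, ip x y = ip y x) (ξ η : UnitAddCircle → E) :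
    loopPair ip ξ (-η) = -loopPair ip ξ η := by
  rw [loopPair_symm ip_symm, loopPair_neg_left, loopPair_symm ip_symm η]

theorem loopPair_smul_right (ip_symm : ∀ x y, ip x y = ip y x) (r : ℝ) (ξ η : UnitAddCircle → E) :
    loopPair ip ξ (r • η) = r * loopPair ip ξ η := by
  rw [loopPair_symm ip_symm, loopPair_smul_left, loopPair_symm ip_symm η]

theorem loopPair_sub_left {ξ ζ η : UnitAddCircle → E} (hξ : LoopSmooth ξ) (hζ : LoopSmooth ζ)
    (hη : LoopSmooth η) : loopPair ip (ξ - ζ) η = loopPair ip ξ η - loopPair ip ζ η := by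
  rw [sub_eq_add_neg, loopPair_add_left ip hξ hζ.neg hη, loopPair_neg_left, sub_eq_add_neg]

theorem loopPair_sub_right (ip_symm : ∀ x y, ip x y = ip y x) {ξ ζ η : UnitAddCircle → E}
    (hξ : LoopSmooth ξ) (hζ : LoopSmooth ζ)
    (hη : LoopSmooth η) : loopPair ip ξ (ζ - η) = loopPair ip ξ ζ - loopPair ip ξ η := by
  rw [sub_eq_add_neg, loopPair_add_right ip_symm hξ hζ hη.neg, loopPair_neg_right ip_symm,
    sub_eq_add_neg]

theorem affBracket_add_left {X Y Z : AffAlg E} (hX : LoopSmooth X.2.1) (hY : LoopSmooth Y.2.1)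
    (hZ : LoopSmooth Z.2.1) : affBracket G ip k (X + Y) Z
      = affBracket G ip k X Z + affBracket G ip k Y Z := by
  simp only [affBracket_eq, Prod.fst_add, Prod.snd_add, loopBracket_add_left,
    loopDeriv_add hX hY, loopPair_add_left ip hX hY hZ.loopDeriv]
  refine Prod.ext (by simp) (Prod.ext ?_ (mul_add _ _ _))
  simp only [Prod.snd_add, Prod.fst_add, smul_add, add_smul]
  abel

/-- The central component is skew by integration by parts and the symmetry of `ip`. -/
theorem affBracket_skew (ip_symm : ∀ x y, ip x y = ip y x) {X Y : AffAlg E}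
    (hX : LoopSmooth X.2.1) (hY : LoopSmooth Y.2.1) :
    affBracket G ip k X Y = -affBracket G ip k Y X := by
  simp only [affBracket_eq]
  rw [loopBracket_skew, loopPair_loopDeriv ip hX hY, loopPair_symm ip_symm]
  refine Prod.ext (by simp) (Prod.ext ?_ (by simp))
  simp only [Prod.snd_neg, Prod.fst_neg]
  abel

theorem affBracket_add_right (ip_symm : ∀ x y, ip x y = ip y x) {X Y Z : AffAlg E}
    (hX : LoopSmooth X.2.1) (hY : LoopSmooth Y.2.1)
    (hZ : LoopSmooth Z.2.1) : affBracket G ip k X (Y + Z)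
      = affBracket G ip k X Y + affBracket G ip k X Z := by
  rw [affBracket_skew k ip_symm hX (hY.add hZ), affBracket_add_left k hY hZ hX,
    affBracket_skew k ip_symm hX hY, affBracket_skew k ip_symm hX hZ, neg_add]

variable {K : Type*} [Group K] [DiffeologicalSpace K] {k}

theorem LevelExtension.twist_loopBracket (ext : LevelExtension E G ip k K) (g : LoopRot E G)
    (ξ η : UnitAddCircle → E) :
    twist g (loopBracket G ξ η) = loopBracket G (twist g ξ) (twist g η) :=
  funext fun _ => ext.gAd_gBracket _ _ _

theorem LevelExtension.loopDeriv_twist (ext : LevelExtension E G ip k K) (g : LoopRot E G)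
    {ξ : UnitAddCircle → E} (hξ : LoopSmooth ξ) : loopDeriv (twist g ξ)
      = twist g (loopDeriv ξ) - loopBracket G (loopLog g) (twist g ξ) := by
  ext θ
  obtain ⟨t, rfl⟩ := exists_coe_eq θ
  have h := ext.fderiv_gAd_inv g.contMDiff_loop hξ t 1
  rw [fderiv_apply_one_eq_deriv, fderiv_apply_one_eq_deriv, ← logDeriv_loop_coe,
    ← loopDeriv_coe ξ] at h
  rw [loopDeriv_coe]
  exact h

theorem LevelExtension.loopPair_loopBracket (ext : LevelExtension E G ip k K)
    (ip_inv : ∀ (g : G) (x y : E), ip (gAd g x) (gAd g y) = ip x y)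
    {ξ η ζ : UnitAddCircle → E} :
    loopPair ip (loopBracket G ξ η) ζ = -loopPair ip η (loopBracket G ξ ζ) := by
  unfold loopPair loopBracket
  rw [← integral_neg]
  refine integral_congr_ae (Filter.Eventually.of_forall fun θ => ?_)
  exact eq_neg_of_add_eq_zero_left (ext.ip_gBracket ip_inv _ _ _)

theorem loopPair_twist (ip_inv : ∀ (g : G) (x y : E), ip (gAd g x) (gAd g y) = ip x y)
    (g : LoopRot E G) (ξ η : UnitAddCircle → E) :
    loopPair ip (twist g ξ) (twist g η) = loopPair ip ξ η := by
  unfold loopPair twist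
  simp only [ip_inv]

/-- Write `l = γ⁻¹γ'`. In the loop component, the bracket produced by differentiating `Ad_{γ⁻¹}`
cancels against the brackets with the added multiples of `l`. The central component reduces to four
pairing identities. -/
theorem LevelExtension.twistAff_affBracket (ext : LevelExtension E G ip k K)
    (ip_symm : ∀ x y, ip x y = ip y x)
    (ip_inv : ∀ (g : G) (x y : E), ip (gAd g x) (gAd g y) = ip x y) (g : LoopRot E G)
    {X Y : AffAlg E} (hX : LoopSmooth X.2.1) (hY : LoopSmooth Y.2.1) :
    twistAff ip k g (affBracket G ip k X Y)
      = affBracket G ip k (twistAff ip k g X) (twistAff ip k g Y) := by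
  obtain ⟨x, ξ, a⟩ := X
  obtain ⟨y, η, b⟩ := Y
  dsimp only at hX hY
  have hl := loopSmooth_loopLog g
  have hX' := hX.twist g
  have hY' := hY.twist g
  have e1 : loopDeriv (twist g ξ + x • (loopLog g))
      = twist g (loopDeriv ξ) - loopBracket G (loopLog g) (twist g ξ) + x • loopDeriv (loopLog g) := by
    rw [loopDeriv_add hX' (hl.smul x), ext.loopDeriv_twist g hX, loopDeriv_smul]
  have e2 : loopDeriv (twist g η + y • (loopLog g))
      = twist g (loopDeriv η) - loopBracket G (loopLog g) (twist g η) + y • loopDeriv (loopLog g) := by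
    rw [loopDeriv_add hY' (hl.smul y), ext.loopDeriv_twist g hY, loopDeriv_smul]
  refine Prod.ext rfl (Prod.ext ?_ ?_)
  · simp only [twistAff, affBracket_eq, e1, e2, twist_add, twist_sub, twist_smul,
      ext.twist_loopBracket, loopBracket_add_left, loopBracket_add_right, loopBracket_smul_left,
      loopBracket_smul_right, loopBracket_self, smul_add, smul_sub, smul_zero, zero_smul]
    rw [loopBracket_skew G (twist g ξ) (loopLog g), smul_comm x y (loopDeriv (loopLog g)), smul_neg]
    abel
  · have t1 := hX.loopDeriv.twist g
    have t2 := hY.loopDeriv.twist g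
    have b1 := hl.loopBracket G hX'
    have b2 := hl.loopBracket G hY'
    have b3 := hX'.loopBracket G hY'
    simp only [twistAff, affBracket_eq, twist_add, twist_sub, twist_smul, ext.twist_loopBracket]
    rw [e2]
    -- `⟨l, l'⟩` is half a total derivative.
    have q1 : loopPair ip (loopLog g) (loopDeriv (loopLog g)) = 0 := by
      have := loopPair_loopDeriv ip hl hl
      rw [loopPair_symm ip_symm (loopDeriv (loopLog g))] at this
      linarith
    -- Infinitesimal invariance moves the bracket onto `[l, l] = 0`.
    have q2 : loopPair ip (loopLog g) (loopBracket G (loopLog g) (twist g η)) = 0 := by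
      have := ext.loopPair_loopBracket ip_inv (ξ := (loopLog g)) (η := (loopLog g)) (ζ := twist g η)
      rw [loopBracket_self] at this
      have h0 : loopPair ip (0 : UnitAddCircle → E) (twist g η) = 0 := by simp [loopPair]
      linarith
    have q3 : loopPair ip (loopLog g) (loopBracket G (twist g ξ) (twist g η))
        = -loopPair ip (twist g ξ) (loopBracket G (loopLog g) (twist g η)) := by
      rw [← ext.loopPair_loopBracket ip_inv, loopBracket_skew G (loopLog g), loopPair_neg_left,
        ext.loopPair_loopBracket ip_inv, neg_neg]
    -- Integration by parts; the bracket from the derivative of the twist pairs to zero with `l`.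
    have q4 : loopPair ip (twist g ξ) (loopDeriv (loopLog g)) = -loopPair ip (loopLog g) (twist g (loopDeriv ξ)) := by
      rw [loopPair_loopDeriv ip hX' hl, ext.loopDeriv_twist g hX, loopPair_sub_left t1 b1 hl,
        ext.loopPair_loopBracket ip_inv, loopBracket_self, loopPair_symm ip_symm (loopLog g)]
      simp [loopPair]
    rw [loopPair_sub_right ip_symm hl (b3.add (t2.smul x)) (t1.smul y),
      loopPair_add_right ip_symm hl b3 (t2.smul x), loopPair_smul_right ip_symm,
      loopPair_smul_right ip_symm, loopPair_add_left ip hX' (hl.smul x)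
        ((t2.sub b2).add (hl.loopDeriv.smul y)), loopPair_smul_left,
      loopPair_add_right ip_symm hX' (t2.sub b2) (hl.loopDeriv.smul y),
      loopPair_add_right ip_symm hl (t2.sub b2) (hl.loopDeriv.smul y),
      loopPair_sub_right ip_symm hX' t2 b2, loopPair_sub_right ip_symm hl t2 b2,
      loopPair_smul_right ip_symm, loopPair_smul_right ip_symm, q1, q2, q3, q4,
      loopPair_twist ip_inv]
    ring

/-- The invariance of the pairing on the affine algebra. -/
theorem affPair_twistAff (ip_symm : ∀ x y, ip x y = ip y x)
    (ip_inv : ∀ (g : G) (x y : E), ip (gAd g x) (gAd g y) = ip x y) (g : LoopRot E G)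
    {X Y : AffAlg E} (hX : LoopSmooth X.2.1) (hY : LoopSmooth Y.2.1) :
    affPair ip k (twistAff ip k g X) (twistAff ip k g Y) = affPair ip k X Y := by
  have hl := loopSmooth_loopLog g
  have hX' := hX.twist g
  have hY' := hY.twist g
  simp only [twistAff, affPair]
  rw [loopPair_add_left ip hX' (hl.smul _) (hY'.add (hl.smul _)), loopPair_smul_left,
    loopPair_add_right ip_symm hX' hY' (hl.smul _), loopPair_add_right ip_symm hl hY' (hl.smul _),
    loopPair_smul_right ip_symm, loopPair_smul_right ip_symm, loopPair_twist ip_inv,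
    loopPair_symm ip_symm (twist g X.2.1) (loopLog g)]
  ring

theorem affPair_shift (a : UnitAddCircle) (X Y : AffAlg E) :
    affPair ip k (shiftAff a X) (shiftAff a Y) = affPair ip k X Y := by
  simp only [affPair, shiftAff, loopPair_shift]

theorem affPair_affAd (ip_symm : ∀ x y, ip x y = ip y x)
    (ip_inv : ∀ (g : G) (x y : E), ip (gAd g x) (gAd g y) = ip x y) (g : LoopRot E G)
    {X Y : AffAlg E} (hX : LoopSmooth X.2.1) (hY : LoopSmooth Y.2.1) :
    affPair ip k (affAd ip k g⁻¹ X) (affAd ip k g⁻¹ Y) = affPair ip k X Y := by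
  rw [affAd_inv ip_inv, affAd_inv ip_inv, affPair_shift, affPair_twistAff ip_symm ip_inv g hX hY]

theorem LevelExtension.affAd_affBracket (ext : LevelExtension E G ip k K)
    (ip_symm : ∀ x y, ip x y = ip y x)
    (ip_inv : ∀ (g : G) (x y : E), ip (gAd g x) (gAd g y) = ip x y) (g : LoopRot E G)
    {X Y : AffAlg E} (hX : LoopSmooth X.2.1) (hY : LoopSmooth Y.2.1) :
    affAd ip k g⁻¹ (affBracket G ip k X Y)
      = affBracket G ip k (affAd ip k g⁻¹ X) (affAd ip k g⁻¹ Y) := by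
  rw [affAd_inv ip_inv, affAd_inv ip_inv, affAd_inv ip_inv, affBracket_shift,
    ext.twistAff_affBracket ip_symm ip_inv g hX hY]

end Bracket

/-! ### Smooth families in the loop group -/

section SmoothLoopRot

variable {E : Type*} [NormedAddCommGroup E] [NormedSpace ℝ E] {G : Type*}
    [TopologicalSpace G] [ChartedSpace E G] [Group G] [LieGroup 𝓘(ℝ, E) ∞ G] [FiniteDimensional ℝ E] {n : ℕ}

/-- The loop component of `γ⁻¹ dγ`. -/
def loopMC (g : Euc n → LoopRot E G) (u v : Euc n) (θ : UnitAddCircle) : E :=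
  logDeriv (fun w => (g w).loop θ) u v

variable {g : Euc n → LoopRot E G}

theorem SmoothLoopRot.loopLog_coe (hg : SmoothLoopRot g) (u : Euc n) (t : ℝ) :
    loopLog (g u) (t : UnitAddCircle)
      = logDeriv (fun z : Euc n × ℝ => (g z.1).loop (z.2 : UnitAddCircle)) (u, t) (0, 1) := by
  rw [logDeriv_loop_coe, logDeriv_comp
    (c := fun z : Euc n × ℝ => (g z.1).loop (z.2 : UnitAddCircle)) (f := fun t : ℝ => (u, t))
    (hg.2.mdifferentiable (by simp) _) (by fun_prop), (hasFDerivAt_prodMk_right u t).fderiv]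
  rfl

theorem SmoothLoopRot.loopMC_coe (hg : SmoothLoopRot g) (u v : Euc n) (t : ℝ) :
    loopMC g u v (t : UnitAddCircle)
      = logDeriv (fun z : Euc n × ℝ => (g z.1).loop (z.2 : UnitAddCircle)) (u, t) (v, 0) := by
  unfold loopMC
  rw [logDeriv_comp
    (c := fun z : Euc n × ℝ => (g z.1).loop (z.2 : UnitAddCircle)) (f := fun u : Euc n => (u, t))
    (hg.2.mdifferentiable (by simp) _) (by fun_prop), (hasFDerivAt_prodMk_left u t).fderiv]
  rfl

theorem SmoothLoopRot.smoothLoop_loopLog (hg : SmoothLoopRot g) :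
    SmoothLoop (fun u => loopLog (g u)) := by
  unfold SmoothLoop
  simp only [hg.loopLog_coe]
  exact contDiff_logDeriv_apply hg.2 contDiff_const

theorem SmoothLoopRot.smoothLoop_loopMC (hg : SmoothLoopRot g) (v : Euc n) :
    SmoothLoop (fun u => loopMC g u v) := by
  unfold SmoothLoop
  simp only [hg.loopMC_coe]
  exact contDiff_logDeriv_apply hg.2 contDiff_const

theorem SmoothLoopRot.smoothLoop_twist (hg : SmoothLoopRot g)
    {ξ : Euc n → UnitAddCircle → E} (hξ : SmoothLoop ξ) : SmoothLoop (fun u => twist (g u) (ξ u)) :=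
  contDiff_gAd_inv hg.2 hξ

variable {ip : LinearMap.BilinForm ℝ E} {k : ℤ}
  {K : Type*} [Group K] [DiffeologicalSpace K]

theorem LevelExtension.dLoop_twist (ext : LevelExtension E G ip k K) (hg : SmoothLoopRot g)
    {ξ : Euc n → UnitAddCircle → E} (hξ : SmoothLoop ξ) (u v : Euc n) :
    dLoop (fun u => twist (g u) (ξ u)) u v
      = twist (g u) (dLoop ξ u v) - loopBracket G (loopMC g u v) (twist (g u) (ξ u)) := by
  ext θ
  obtain ⟨t, rfl⟩ := exists_coe_eq θ
  rw [(hg.smoothLoop_twist hξ).dLoop_coe]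
  refine (ext.fderiv_gAd_inv hg.2 hξ (u, t) (v, 0)).trans ?_
  rw [← hg.loopMC_coe, ← hξ.dLoop_coe]
  rfl

/-- The Maurer-Cartan equation for `(u, t) ↦ γ_u(t)`, in one parameter direction and the loop
direction: it exchanges the two derivatives at the cost of a bracket. -/
theorem LevelExtension.dLoop_loopLog (ext : LevelExtension E G ip k K) (hg : SmoothLoopRot g)
    (u v : Euc n) : dLoop (fun u => loopLog (g u)) u v
      = loopDeriv (loopMC g u v) - loopBracket G (loopMC g u v) (loopLog (g u)) := by
  have := FiniteDimensional.complete ℝ E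
  ext θ
  obtain ⟨t, rfl⟩ := exists_coe_eq θ
  have h := ext.maurerCartan_eq hg.2 (u, t) (v, 0) (0, 1)
  have h1 := hg.smoothLoop_loopLog.dLoop_coe u v t
  have h2 := (hg.smoothLoop_loopMC v).loopDeriv_coe u t
  simp only [hg.loopLog_coe] at h1
  simp only [hg.loopMC_coe] at h2
  rw [← h1, ← h2, ← hg.loopMC_coe, ← hg.loopLog_coe, sub_add_eq_add_sub, sub_eq_zero] at h
  exact eq_sub_of_add_eq h

end SmoothLoopRot

/-! ### Differentiating the adjoint action on the affine algebra -/

section Affine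

variable {E : Type*} [NormedAddCommGroup E] [NormedSpace ℝ E] {n : ℕ}

/-- The derivative of a family of elements of the affine algebra. -/
def dAff (β : Euc n → AffAlg E) (u v : Euc n) : AffAlg E :=
  (fderiv ℝ (fun u => (β u).1) u v, dLoop (fun u => (β u).2.1) u v,
    fderiv ℝ (fun u => (β u).2.2) u v)

variable {β δ : Euc n → AffAlg E}

theorem SmoothAff.loopSmooth (hβ : SmoothAff E β) (u : Euc n) : LoopSmooth (β u).2.1 :=
  hβ.2.1.loopSmooth u

theorem SmoothAff.dAff (hβ : SmoothAff E β) (v : Euc n) : SmoothAff E (fun u => dAff β u v) :=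
  ⟨(hβ.1.fderiv_right (m := ∞) (by simp)).clm_apply contDiff_const, hβ.2.1.dLoop v,
    (hβ.2.2.fderiv_right (m := ∞) (by simp)).clm_apply contDiff_const⟩

theorem dAff_add (hβ : SmoothAff E β) (hδ : SmoothAff E δ) (u v : Euc n) :
    LoopLift.dAff (fun u => β u + δ u) u v = LoopLift.dAff β u v + LoopLift.dAff δ u v := by
  refine Prod.ext ?_ (Prod.ext (funext fun θ => ?_) ?_)
  · exact DFunLike.congr_fun (fderiv_add (hβ.1.differentiable (by simp) u)
      (hδ.1.differentiable (by simp) u)) v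
  · exact DFunLike.congr_fun (fderiv_add (hβ.2.1.differentiableAt θ u)
      (hδ.2.1.differentiableAt θ u)) v
  · exact DFunLike.congr_fun (fderiv_add (hβ.2.2.differentiable (by simp) u)
      (hδ.2.2.differentiable (by simp) u)) v

theorem affCurv_eq (G : Type*) [TopologicalSpace G] [ChartedSpace E G] [Group G]
    (ip : LinearMap.BilinForm ℝ E) (k : ℤ) (α : Euc n → Euc n → AffAlg E) (u v w : Euc n) :
    affCurv G ip k α u v w = LoopLift.dAff (fun u => α u w) u v - LoopLift.dAff (fun u => α u v) u w
      + affBracket G ip k (α u v) (α u w) := rfl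

variable [FiniteDimensional ℝ E] {G : Type*} [TopologicalSpace G] [ChartedSpace E G] [Group G]
  [LieGroup 𝓘(ℝ, E) ∞ G] {g : Euc n → LoopRot E G} {ip : LinearMap.BilinForm ℝ E} {k : ℤ}
  {K : Type*} [Group K] [DiffeologicalSpace K]

theorem SmoothAff.twistAff (hβ : SmoothAff E β) (hg : SmoothLoopRot g) :
    SmoothAff E (fun u => twistAff ip k (g u) (β u)) := by
  have hl := hg.smoothLoop_loopLog
  have ht := hg.smoothLoop_twist hβ.2.1
  refine ⟨hβ.1, ht.add (hl.smul hβ.1), (hβ.2.2.add (contDiff_const.mul (hl.contDiff_loopPair ip ht))).add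
    ((contDiff_const.mul hβ.1).mul (hl.contDiff_loopPair ip hl))⟩

/-- The derivative of `Ad_{γ⁻¹}` is minus the bracket with `γ⁻¹dγ`. In the central component the
cocycle term of that bracket, integrated by parts, accounts for the derivative of the terms in
`γ⁻¹γ'`. -/
theorem LevelExtension.dAff_twistAff (ext : LevelExtension E G ip k K)
    (ip_symm : ∀ x y, ip x y = ip y x)
    (ip_inv : ∀ (g : G) (x y : E), ip (gAd g x) (gAd g y) = ip x y)
    (hβ : SmoothAff E β) (hg : SmoothLoopRot g) (u v : Euc n) :
    LoopLift.dAff (fun u => LoopLift.twistAff ip k (g u) (β u)) u v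
      = LoopLift.twistAff ip k (g u) (LoopLift.dAff β u v)
        - affBracket G ip k (0, loopMC g u v, 0) (LoopLift.twistAff ip k (g u) (β u)) := by
  have hl := hg.smoothLoop_loopLog
  have ht := hg.smoothLoop_twist hβ.2.1
  have hx : DifferentiableAt ℝ (fun u => (β u).1) u := hβ.1.differentiable (by simp) u
  refine Prod.ext (by simp [affBracket_eq, LoopLift.dAff, LoopLift.twistAff]) (Prod.ext ?_ ?_)
  · have h1 : dLoop (fun u => twist (g u) (β u).2.1 + (β u).1 • loopLog (g u)) u v
        = dLoop (fun u => twist (g u) (β u).2.1) u v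
          + ((β u).1 • dLoop (fun u => loopLog (g u)) u v
            + fderiv ℝ (fun u => (β u).1) u v • loopLog (g u)) := by
      ext θ
      have h := (ht.differentiableAt θ u).hasFDerivAt.add
        (hx.hasFDerivAt.smul (hl.differentiableAt θ u).hasFDerivAt)
      exact DFunLike.congr_fun h.fderiv v
    refine h1.trans ?_
    rw [ext.dLoop_twist hg hβ.2.1, ext.dLoop_loopLog hg]
    simp only [LoopLift.twistAff, LoopLift.dAff, affBracket_eq, Prod.snd_sub, Prod.fst_sub,
      loopBracket_add_right, loopBracket_smul_right, zero_smul, smul_sub]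
    abel
  · have hy : DifferentiableAt ℝ (fun u => (β u).2.2) u := hβ.2.2.differentiable (by simp) u
    have p1 := (hl.contDiff_loopPair ip ht).differentiable (by simp) u
    have p2 := (hl.contDiff_loopPair ip hl).differentiable (by simp) u
    have h := ((hy.hasFDerivAt.add (p1.hasFDerivAt.const_mul (k : ℝ))).add
      ((hx.hasFDerivAt.const_mul (k / 2 : ℝ)).mul p2.hasFDerivAt))
    refine (DFunLike.congr_fun h.fderiv v).trans ?_
    have la := (hg.smoothLoop_loopMC v).loopSmooth u
    have ll := hl.loopSmooth u
    have lt := ht.loopSmooth u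
    have ld := (hg.smoothLoop_twist (hβ.2.1.dLoop v)).loopSmooth u
    have b1 := la.loopBracket G ll
    have b2 := la.loopBracket G lt
    simp only [add_apply, smul_apply, smul_eq_mul, fderiv_loopPair ip hl ht,
      fderiv_loopPair ip hl hl, ext.dLoop_twist hg hβ.2.1, ext.dLoop_loopLog hg,
      LoopLift.twistAff, LoopLift.dAff, affBracket_eq, Prod.snd_sub]
    have q1 : loopPair ip (loopBracket G (loopMC g u v) (loopLog (g u))) (loopLog (g u)) = 0 := by
      have := ext.loopPair_loopBracket ip_inv (ξ := loopMC g u v) (η := loopLog (g u))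
        (ζ := loopLog (g u))
      rw [loopPair_symm ip_symm (loopLog (g u))] at this
      linarith
    have q2 : loopPair ip (loopBracket G (loopMC g u v) (loopLog (g u))) (twist (g u) (β u).2.1)
        = -loopPair ip (loopLog (g u))
          (loopBracket G (loopMC g u v) (twist (g u) (β u).2.1)) :=
      ext.loopPair_loopBracket ip_inv
    rw [loopPair_sub_left la.loopDeriv b1 lt, loopPair_sub_right ip_symm ll ld b2,
      loopPair_sub_left la.loopDeriv b1 ll, loopPair_sub_right ip_symm ll la.loopDeriv b1,
      loopPair_loopDeriv ip la (lt.add (ll.smul _)),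
      loopPair_add_right ip_symm la.loopDeriv lt (ll.smul _), loopPair_smul_right ip_symm,
      loopPair_symm ip_symm (loopLog (g u)) (loopDeriv _),
      loopPair_symm ip_symm (loopLog (g u)) (loopBracket G _ (loopLog (g u))), q1, q2]
    ring

theorem SmoothLoopRot.angle_lift (hg : SmoothLoopRot g) : ∃ c : Euc n → ℝ, ContDiff ℝ ∞ c ∧
    (∀ u, (g u).angle = (c u : UnitAddCircle)) ∧ ∀ u v, maurerCartan g u v
      = (fderiv ℝ c u v, fun θ => loopMC g u v (θ - (c u : UnitAddCircle))) := by
  obtain ⟨c, hc, hgc⟩ := hg.1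
  refine ⟨c, hc, hgc, fun u v => Prod.ext ?_ (funext fun θ => ?_)⟩
  · simp only [maurerCartan, hgc]
    exact angleDeriv_coe (hc.differentiable (by simp) u) v
  · simp only [maurerCartan, hgc]
    rfl

theorem SmoothAff.affAd (ip_inv : ∀ (g : G) (x y : E), ip (gAd g x) (gAd g y) = ip x y)
    (hβ : SmoothAff E β) (hg : SmoothLoopRot g) :
    SmoothAff E (fun u => affAd ip k (g u)⁻¹ (β u)) := by
  obtain ⟨c, hc, hgc, -⟩ := hg.angle_lift
  simp only [affAd_inv ip_inv, hgc]
  have h := hβ.twistAff (ip := ip) (k := k) hg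
  simp only [shiftAff, ← sub_eq_add_neg]
  exact ⟨h.1, SmoothLoop.shift hc h.2.1, h.2.2⟩

/-- The derivative of the adjoint action on the affine algebra. The central component of the
Maurer-Cartan form is irrelevant, as the centre acts trivially. -/
theorem LevelExtension.dAff_affAd (ext : LevelExtension E G ip k K)
    (ip_symm : ∀ x y, ip x y = ip y x)
    (ip_inv : ∀ (g : G) (x y : E), ip (gAd g x) (gAd g y) = ip x y)
    (hβ : SmoothAff E β) (hg : SmoothLoopRot g) (u v : Euc n) (y : ℝ) :
    LoopLift.dAff (fun u => LoopLift.affAd ip k (g u)⁻¹ (β u)) u v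
      = LoopLift.affAd ip k (g u)⁻¹ (LoopLift.dAff β u v)
        - affBracket G ip k (sigma (maurerCartan g u v) + centre y)
            (LoopLift.affAd ip k (g u)⁻¹ (β u)) := by
  obtain ⟨c, hc, hgc, hmc⟩ := hg.angle_lift
  have h := hβ.twistAff (ip := ip) (k := k) hg
  have key := ext.dAff_twistAff ip_symm ip_inv hβ hg u v
  simp only [affAd_inv ip_inv, hgc, hmc]
  set N := fun u => LoopLift.twistAff ip k (g u) (β u) with hN
  change LoopLift.dAff N u v = LoopLift.twistAff ip k (g u) (LoopLift.dAff β u v)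
    - affBracket G ip k (0, loopMC g u v, 0) (N u) at key
  -- Differentiating the rotation adds a multiple of the loop derivative, exactly the contribution
  -- of the circle component `dc` of the Maurer-Cartan form to the bracket.
  have h1 : LoopLift.dAff (fun u => shiftAff (-(c u : UnitAddCircle)) (N u)) u v
      = shiftAff (-(c u : UnitAddCircle)) (LoopLift.dAff N u v)
        - (0, fderiv ℝ c u v • fun θ => loopDeriv (N u).2.1 (θ + -(c u : UnitAddCircle)), 0) := by
    refine Prod.ext (by simp [LoopLift.dAff, shiftAff]) (Prod.ext (funext fun θ => ?_)
      (by simp [LoopLift.dAff, shiftAff]))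
    have h2 := dLoop_shift hc h.2.1 u v θ
    simp only [sub_eq_add_neg] at h2
    refine h2.trans ?_
    rw [← sub_eq_add_neg]
    rfl
  have h3 : sigma ((fderiv ℝ c u v, fun θ => loopMC g u v (θ - (c u : UnitAddCircle))) : RotAlg E)
      + centre y = shiftAff (-(c u : UnitAddCircle)) (fderiv ℝ c u v, loopMC g u v, y) := by
    simp [sigma, centre, shiftAff, sub_eq_add_neg]
  change LoopLift.dAff (fun u => shiftAff (-(c u : UnitAddCircle)) (N u)) u v = _
  rw [h1, key, h3]
  change _ = _ - affBracket G ip k _ (shiftAff (-(c u : UnitAddCircle)) (N u))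
  rw [affBracket_shift]
  refine Prod.ext (by simp [shiftAff, affBracket_eq]) (Prod.ext (funext fun θ => ?_)
    (by simp [shiftAff, affBracket_eq]))
  simp only [shiftAff, affBracket_eq, Prod.snd_sub, Prod.fst_sub, Pi.sub_apply, Pi.add_apply,
    Pi.smul_apply, zero_smul, add_zero]
  abel

end Affine

/-! ### Curvature under gauge transformations -/

section Gauge

variable {E : Type*} [NormedAddCommGroup E] [NormedSpace ℝ E] [FiniteDimensional ℝ E]
  {G : Type*} [TopologicalSpace G] [ChartedSpace E G] [Group G]
  [LieGroup 𝓘(ℝ, E) ∞ G] {ip : LinearMap.BilinForm ℝ E} {k : ℤ}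
  {K : Type*} [Group K] [DiffeologicalSpace K] {n : ℕ}

theorem affAd_inv_add (ip_symm : ∀ x y, ip x y = ip y x)
    (ip_inv : ∀ (g : G) (x y : E), ip (gAd g x) (gAd g y) = ip x y) (g : LoopRot E G)
    {X Y : AffAlg E} (hX : LoopSmooth X.2.1) (hY : LoopSmooth Y.2.1) :
    affAd ip k g⁻¹ (X + Y) = affAd ip k g⁻¹ X + affAd ip k g⁻¹ Y := by
  have h : twistAff ip k g (X + Y) = twistAff ip k g X + twistAff ip k g Y := by
    simp only [twistAff, Prod.snd_add, Prod.fst_add, twist_add,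
      loopPair_add_right ip_symm (loopSmooth_loopLog g) (hX.twist g) (hY.twist g), add_smul]
    refine Prod.ext rfl (Prod.ext ?_ ?_)
    · simp only [Prod.snd_add, Prod.fst_add]
      abel
    · simp only [Prod.snd_add]
      ring
  simp only [affAd_inv ip_inv, h]
  rfl

theorem affAd_inv_neg (ip_symm : ∀ x y, ip x y = ip y x)
    (ip_inv : ∀ (g : G) (x y : E), ip (gAd g x) (gAd g y) = ip x y) (g : LoopRot E G)
    (X : AffAlg E) : affAd ip k g⁻¹ (-X) = -affAd ip k g⁻¹ X := by
  have h : twistAff ip k g (-X) = -twistAff ip k g X := by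
    simp only [twistAff, Prod.snd_neg, Prod.fst_neg, twist_neg, loopPair_neg_right ip_symm,
      neg_smul]
    refine Prod.ext rfl (Prod.ext ?_ ?_)
    · simp only [Prod.snd_neg, Prod.fst_neg]
      abel
    · simp only [Prod.snd_neg]
      ring
  simp only [affAd_inv ip_inv, h]
  rfl

theorem affAd_inv_sub (ip_symm : ∀ x y, ip x y = ip y x)
    (ip_inv : ∀ (g : G) (x y : E), ip (gAd g x) (gAd g y) = ip x y) (g : LoopRot E G)
    {X Y : AffAlg E} (hX : LoopSmooth X.2.1) (hY : LoopSmooth Y.2.1) :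
    affAd ip k g⁻¹ (X - Y) = affAd ip k g⁻¹ X - affAd ip k g⁻¹ Y := by
  rw [sub_eq_add_neg, affAd_inv_add ip_symm ip_inv g hX hY.neg, affAd_inv_neg ip_symm ip_inv,
    sub_eq_add_neg]

theorem affAd_add_centre (g : LoopRot E G) (X : AffAlg E) (y : ℝ) :
    affAd ip k g (X + centre y) = affAd ip k g X + centre y := by
  refine Prod.ext ?_ (Prod.ext ?_ ?_)
  · simp [affAd, proj, centre]
  · simp [affAd, proj, centre]
  · simp only [affAd, centre, Prod.snd_add, Prod.fst_add, add_zero]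
    ring

theorem LevelExtension.smoothAff_mc (ext : LevelExtension E G ip k K) (h : Euc n → K)
    (hh : IsPlot h) (v : Euc n) : SmoothAff E (fun u => ext.mc h hh u v) := by
  obtain ⟨c, hc, -, hmc⟩ := (ext.smooth_q h hh).angle_lift
  simp only [LevelExtension.mc, hmc, sigma, centre, Prod.mk_add_mk, add_zero, zero_add]
  exact ⟨(hc.fderiv_right (m := ∞) (by simp)).clm_apply contDiff_const,
    SmoothLoop.shift hc ((ext.smooth_q h hh).smoothLoop_loopMC v), ext.ν.smooth h hh v⟩

/-- The curvature of a gauge transform. -/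
theorem LevelExtension.affCurv_gauge (ext : LevelExtension E G ip k K)
    (ip_symm : ∀ x y, ip x y = ip y x)
    (ip_inv : ∀ (g : G) (x y : E), ip (gAd g x) (gAd g y) = ip x y) (h : Euc n → K)
    (hh : IsPlot h) {A : Euc n → Euc n → AffAlg E} (hA : ∀ v, SmoothAff E (fun u => A u v))
    (u v w : Euc n) :
    affCurv G ip k (fun u v => ext.mc h hh u v + affAd ip k (ext.q (h u))⁻¹ (A u v)) u v w
      = affAd ip k (ext.q (h u))⁻¹ (affCurv G ip k A u v w) := by
  have hg := ext.smooth_q h hh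
  have hM := ext.smoothAff_mc h hh
  have hN : ∀ v, SmoothAff E (fun u => affAd ip k (ext.q (h u))⁻¹ (A u v)) := fun v =>
    (hA v).affAd ip_inv hg
  have h0 := ext.structure_eq h hh u v w
  change affCurv G ip k (ext.mc h hh) u v w = 0 at h0
  have hd : ∀ v w, dAff (fun u => affAd ip k (ext.q (h u))⁻¹ (A u w)) u v
      = affAd ip k (ext.q (h u))⁻¹ (dAff (fun u => A u w) u v)
        - affBracket G ip k (ext.mc h hh u v) (affAd ip k (ext.q (h u))⁻¹ (A u w)) := fun v w =>
    ext.dAff_affAd ip_symm ip_inv (hA w) hg u v _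
  have hb : LoopSmooth (affBracket G ip k (A u v) (A u w)).2.1 := by
    rw [affBracket_eq]
    exact ((((hA v).loopSmooth u).loopBracket G ((hA w).loopSmooth u)).add
      (((hA w).loopSmooth u).loopDeriv.smul _)).sub (((hA v).loopSmooth u).loopDeriv.smul _)
  rw [affCurv_eq] at h0 ⊢
  have d1 := ((hA w).dAff v).loopSmooth u
  have d2 := ((hA v).dAff w).loopSmooth u
  -- With `M` the Maurer-Cartan form and `N = Ad_{h⁻¹} A`, the mixed brackets of `M` and `N` cancel
  -- those from the derivative of `Ad_{h⁻¹}`. The terms in `M` alone form the structure equation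
  -- `h0`.
  rw [affCurv_eq, dAff_add (hM w) (hN w), dAff_add (hM v) (hN v), hd, hd,
    affBracket_add_left k ((hM v).loopSmooth u) ((hN v).loopSmooth u)
      (((hM w).loopSmooth u).add ((hN w).loopSmooth u)),
    affBracket_add_right k ip_symm ((hM v).loopSmooth u) ((hM w).loopSmooth u)
      ((hN w).loopSmooth u),
    affBracket_add_right k ip_symm ((hN v).loopSmooth u) ((hM w).loopSmooth u)
      ((hN w).loopSmooth u),
    affBracket_skew k ip_symm ((hN v).loopSmooth u) ((hM w).loopSmooth u),
    affAd_inv_add ip_symm ip_inv _ (d1.sub d2) hb,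
    affAd_inv_sub ip_symm ip_inv _ d1 d2,
    ext.affAd_affBracket ip_symm ip_inv _ ((hA v).loopSmooth u) ((hA w).loopSmooth u)]
  rw [← sub_eq_zero, ← h0]
  abel

end Gauge

/-! ### Gauge transformation of the connection -/

section Connection

variable {E : Type*} [NormedAddCommGroup E] [NormedSpace ℝ E]
  {G : Type*} [TopologicalSpace G] [ChartedSpace E G] [Group G]
  [LieGroup 𝓘(ℝ, E) ∞ G] {n : ℕ} {Q B : Type*} [DiffeologicalSpace Q] [DiffeologicalSpace B]
  [MulAction (LoopRot E G)ᵐᵒᵖ Q] {π : Q → B}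

theorem SmoothLoopRot.comp {m : ℕ} {g : Euc n → LoopRot E G} (hg : SmoothLoopRot g)
    {f : Euc m → Euc n} (hf : ContDiff ℝ ∞ f) : SmoothLoopRot (fun u => g (f u)) := by
  obtain ⟨⟨c, hc, hgc⟩, h2⟩ := hg
  refine ⟨⟨fun u => c (f u), hc.comp hf, fun u => hgc _⟩, ?_⟩
  have h3 : ContDiff ℝ ∞ (fun z : Euc m × ℝ => (f z.1, z.2)) := by fun_prop
  exact h2.comp h3.contMDiff

theorem smoothLoopRot_fun_const (g : LoopRot E G) : SmoothLoopRot (fun _ : Euc n => g) := by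
  obtain ⟨t, ht⟩ := exists_coe_eq g.angle
  exact ⟨⟨fun _ => t, contDiff_const, fun _ => ht.symm⟩,
    g.contMDiff_loop.comp contDiff_snd.contMDiff⟩

theorem OneForm.val_congr {V : Type*} [AddCommGroup V] [Module ℝ V]
    {S : ∀ ⦃n : ℕ⦄, (Euc n → V) → Prop} (α : OneForm Q V S) {p p' : Euc n → Q} (h : p = p')
    (hp : IsPlot p) (hp' : IsPlot p') : α.val p hp = α.val p' hp' := by
  subst h
  rfl

/-- The gauge transformation of the connection. -/
theorem Connection.form_ract (L : Connection E G Q) (hπ : IsPrincipalBundle E G π)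
    (p : Euc n → Q) (hp : IsPlot p) {g : Euc n → LoopRot E G} (hg : SmoothLoopRot g)
    (hpg : IsPlot (fun u => ract (p u) (g u))) (u v : Euc n) :
    L.form.val (fun u => ract (p u) (g u)) hpg u v
      = maurerCartan g u v + rotAd (g u)⁻¹ (L.form.val p hp u v) := by
  -- The plot `p·g` is the diagonal of the two-variable plot `(x, y) ↦ p(x)·g(y)`. By linearity on
  -- `(v, v) = (v, 0) + (0, v)`, equivariance evaluates the first summand and the vertical condition
  -- the second.
  let e : Euc (n + n) ≃L[ℝ] Euc n × Euc n := EuclideanSpace.finAddEquivProd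
  let P : Euc (n + n) → Q := fun z => ract (p (e z).1) (g (e z).2)
  have h1 : ContDiff ℝ ∞ (fun z => (e z).1) := contDiff_fst.comp e.contDiff
  have h2 : ContDiff ℝ ∞ (fun z => (e z).2) := contDiff_snd.comp e.contDiff
  have hP : IsPlot P := hπ.smooth_act _ _ (isPlot_reparam hp h1) (hg.comp h2)
  have key : ∀ (f : Euc n → Euc n × Euc n) (f' : Euc n →L[ℝ] Euc n × Euc n)
      (_ : ContDiff ℝ ∞ f) (_ : HasFDerivAt f f' u)
      (hr : IsPlot (fun x => ract (p (f x).1) (g (f x).2))),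
      L.form.val (fun x => ract (p (f x).1) (g (f x).2)) hr u v
        = L.form.val P hP (e.symm (f u)) (e.symm (f' v)) := by
    intro f f' hf hf' hr
    have h3 := L.form.natural P hP (fun x => e.symm (f x)) (e.symm.contDiff.comp hf) u v
    have h4 : HasFDerivAt (fun x => e.symm (f x)) ((e.symm : _ →L[ℝ] Euc (n + n)).comp f') u :=
      e.symm.hasFDerivAt.comp u hf'
    rw [h4.fderiv] at h3
    rw [← L.form.val_congr (p := P ∘ fun x => e.symm (f x)) (by ext x; simp [P])
      (isPlot_reparam hP (e.symm.contDiff.comp hf)) hr]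
    exact h3
  have k1 := key (fun x => (x, x))
    ((ContinuousLinearMap.id ℝ (Euc n)).prod (ContinuousLinearMap.id ℝ (Euc n)))
    (contDiff_id.prodMk contDiff_id) ((hasFDerivAt_id u).prodMk (hasFDerivAt_id u)) hpg
  have hp2 : IsPlot (fun x => ract (p x) (g u)) :=
    hπ.smooth_act _ _ hp (smoothLoopRot_fun_const (g u))
  have hp3 : IsPlot (fun x => ract (p u) (g x)) := hπ.smooth_act _ _ isPlot_const hg
  have k2 := key (fun x => (x, u)) (ContinuousLinearMap.inl ℝ (Euc n) (Euc n))
    (contDiff_id.prodMk contDiff_const) (hasFDerivAt_prodMk_left u u) hp2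
  have k3 := key (fun x => (u, x)) (ContinuousLinearMap.inr ℝ (Euc n) (Euc n))
    (contDiff_const.prodMk contDiff_id) (hasFDerivAt_prodMk_right u u) hp3
  rw [L.equivariant p hp (g u) hp2] at k2
  rw [L.vertical (p u) g hg hp3] at k3
  refine k1.trans ?_
  rw [k2, k3, ← map_add, ← map_add]
  congr 2
  simp

end Connection

/-! ### The exterior derivative on parameter spaces -/

section ExteriorDerivative

variable {F : Type*} [NormedAddCommGroup F] [NormedSpace ℝ F] {n : ℕ}

theorem extD_skew (α : Euc n → Euc n → F) (u v w : Euc n) : extD α u v w = -extD α u w v :=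
  (neg_sub _ _).symm

theorem extD_add_left {α : Euc n → Euc n →ₗ[ℝ] F} (hα : ∀ v, ContDiff ℝ ∞ (fun u => α u v))
    (u v v' w : Euc n) : extD (fun u v => α u v) u (v + v') w
      = extD (fun u v => α u v) u v w + extD (fun u v => α u v) u v' w := by
  have hd : ∀ v, DifferentiableAt ℝ (fun u => α u v) u := fun v =>
    (hα v).differentiable (by simp) u
  simp only [extD, map_add, fderiv_fun_add (hd v) (hd v'), add_apply]
  abel

theorem extD_smul_left {α : Euc n → Euc n →ₗ[ℝ] F} (hα : ∀ v, ContDiff ℝ ∞ (fun u => α u v))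
    (r : ℝ) (u v w : Euc n) : extD (fun u v => α u v) u (r • v) w
      = r • extD (fun u v => α u v) u v w := by
  have hd : ∀ v, DifferentiableAt ℝ (fun u => α u v) u := fun v =>
    (hα v).differentiable (by simp) u
  simp only [extD, map_smul, fderiv_fun_const_smul (hd v), smul_apply, smul_sub]

theorem contDiff_extD {α : Euc n → Euc n → F} (hα : ∀ v, ContDiff ℝ ∞ (fun u => α u v))
    (v w : Euc n) : ContDiff ℝ ∞ (fun u => extD α u v w) :=
  (((hα w).fderiv_right (m := ∞) (by simp)).clm_apply contDiff_const).sub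
    (((hα v).fderiv_right (m := ∞) (by simp)).clm_apply contDiff_const)

/-- The chain rule leaves a term in the second derivative of `f`, which is symmetric and drops out
on antisymmetrising. -/
theorem extD_pullback {m : ℕ} {α : Euc n → Euc n →ₗ[ℝ] F}
    (hα : ∀ v, ContDiff ℝ ∞ (fun u => α u v)) {f : Euc m → Euc n} (hf : ContDiff ℝ ∞ f)
    (u v w : Euc m) : extD (fun u v => α (f u) (fderiv ℝ f u v)) u v w
      = extD (fun u v => α u v) (f u) (fderiv ℝ f u v) (fderiv ℝ f u w) := by
  let A : Euc n → Euc n →L[ℝ] F := fun u => LinearMap.toContinuousLinearMap (α u)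
  have hA : ContDiff ℝ ∞ A := contDiff_clm_apply_iff.2 hα
  have hfd : ContDiff ℝ ∞ (fun u => fderiv ℝ f u) := hf.fderiv_right (by simp)
  have hA' : HasFDerivAt (fun u => A (f u)) ((fderiv ℝ A (f u)).comp (fderiv ℝ f u)) u :=
    (hA.differentiable (by simp) (f u)).hasFDerivAt.comp u
      (hf.differentiable (by simp) u).hasFDerivAt
  have hf2 : ∀ w, HasFDerivAt (fun u => fderiv ℝ f u w) ((fderiv ℝ (fderiv ℝ f) u).flip w) u := by
    intro w
    have h := (hfd.differentiable (by simp) u).hasFDerivAt.clm_apply (hasFDerivAt_const w u)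
    refine h.congr_fderiv ?_
    ext x
    simp
  have h1 : ∀ v w, fderiv ℝ (fun u => α (f u) (fderiv ℝ f u w)) u v
      = fderiv ℝ A (f u) (fderiv ℝ f u v) (fderiv ℝ f u w)
        + A (f u) (fderiv ℝ (fderiv ℝ f) u v w) := by
    intro v w
    have h := (hA'.clm_apply (hf2 w)).fderiv
    refine (DFunLike.congr_fun h v).trans ?_
    simp [add_comm]
  have h2 : ∀ x y, fderiv ℝ (fun u => α u y) (f u) x = fderiv ℝ A (f u) x y := by
    intro x y
    have h := ((hA.differentiable (by simp) (f u)).hasFDerivAt.clm_apply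
      (hasFDerivAt_const y (f u))).fderiv
    refine (DFunLike.congr_fun h x).trans ?_
    simp
  have hs : fderiv ℝ (fderiv ℝ f) u v w = fderiv ℝ (fderiv ℝ f) u w v :=
    (hf.contDiffAt.isSymmSndFDerivAt (by
      rw [minSmoothness_of_isRCLikeNormedField]
      exact WithTop.coe_le_coe.2 le_top)).eq v w
  simp only [extD, h1, h2, hs]
  abel

end ExteriorDerivative

/-! ### The curvature of the connection as a 2-form -/

section Curvature

variable {E : Type*} [NormedAddCommGroup E] [NormedSpace ℝ E] [FiniteDimensional ℝ E]
  {G : Type*} [TopologicalSpace G] [ChartedSpace E G] [Group G]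
  [LieGroup 𝓘(ℝ, E) ∞ G] {n : ℕ} {Q : Type*} [DiffeologicalSpace Q]
  [MulAction (LoopRot E G)ᵐᵒᵖ Q]

variable (G) in
theorem rotBracket_eq (X Y : RotAlg E) : rotBracket G X Y = (0, loopBracket G X.2 Y.2
    + X.1 • loopDeriv Y.2 - Y.1 • loopDeriv X.2) := rfl

variable (G) in
theorem rotBracket_skew (X Y : RotAlg E) : rotBracket G X Y = -rotBracket G Y X := by
  simp only [rotBracket_eq]
  rw [loopBracket_skew]
  refine Prod.ext (by simp) ?_
  simp only [Prod.snd_neg]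
  abel

variable (G) in
theorem rotBracket_add_left {X Y Z : RotAlg E} (hX : LoopSmooth X.2) (hY : LoopSmooth Y.2) :
    rotBracket G (X + Y) Z = rotBracket G X Z + rotBracket G Y Z := by
  simp only [rotBracket_eq, Prod.fst_add, Prod.snd_add, loopBracket_add_left, loopDeriv_add hX hY]
  refine Prod.ext (by simp) ?_
  simp only [Prod.snd_add, smul_add, add_smul]
  abel

variable (G) in
theorem rotBracket_smul_left (r : ℝ) (X Z : RotAlg E) :
    rotBracket G (r • X) Z = r • rotBracket G X Z := by
  simp only [rotBracket_eq, Prod.smul_fst, Prod.smul_snd, loopBracket_smul_left, loopDeriv_smul]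
  refine Prod.ext (by simp) ?_
  simp only [Prod.smul_snd, smul_add, smul_sub, smul_smul, smul_eq_mul, mul_comm]

variable (L : Connection E G Q) (p : Euc n → Q) (hp : IsPlot p)

/-- The circle component of a connection on a plot. -/
def Connection.lamL (u : Euc n) : Euc n →ₗ[ℝ] ℝ :=
  (LinearMap.fst ℝ ℝ (UnitAddCircle → E)) ∘ₗ L.form.val p hp u

/-- The loop component of a connection on a plot, at a point of the circle. -/
def Connection.LamL (θ : UnitAddCircle) (u : Euc n) : Euc n →ₗ[ℝ] E :=
  (LinearMap.proj θ ∘ₗ LinearMap.snd ℝ ℝ (UnitAddCircle → E)) ∘ₗ L.form.val p hp u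

theorem Connection.contDiff_lamL (v : Euc n) : ContDiff ℝ ∞ (fun u => L.lamL p hp u v) :=
  (L.form.smooth p hp v).1

theorem Connection.contDiff_LamL (θ : UnitAddCircle) (v : Euc n) :
    ContDiff ℝ ∞ (fun u => L.LamL p hp θ u v) :=
  (L.form.smooth p hp v).2.contDiff θ

theorem Connection.curv_eq (u v w : Euc n) : L.curv p hp u v w
    = (extD (fun u v => L.lamL p hp u v) u v w,
        fun θ => extD (fun u v => L.LamL p hp θ u v) u v w)
      + rotBracket G (L.form.val p hp u v) (L.form.val p hp u w) := rfl

theorem Connection.curv_skew (u v w : Euc n) : L.curv p hp u v w = -L.curv p hp u w v := by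
  rw [L.curv_eq, L.curv_eq, rotBracket_skew, extD_skew, neg_add]
  congr 1
  refine Prod.ext rfl (funext fun θ => extD_skew _ _ _ _)

theorem Connection.curv_self (u v : Euc n) : L.curv p hp u v v = 0 := by
  rw [L.curv_eq, rotBracket_eq, loopBracket_self]
  refine Prod.ext ?_ (funext fun θ => ?_)
  · simp [extD]
  · simp [extD]

theorem Connection.curv_add_left (u v v' w : Euc n) : L.curv p hp u (v + v') w
    = L.curv p hp u v w + L.curv p hp u v' w := by
  have h1 : ((fun θ => extD (fun u v => L.LamL p hp θ u v) u (v + v') w) : UnitAddCircle → E)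
      = (fun θ => extD (fun u v => L.LamL p hp θ u v) u v w)
        + fun θ => extD (fun u v => L.LamL p hp θ u v) u v' w :=
    funext fun θ => extD_add_left (L.contDiff_LamL p hp θ) u v v' w
  rw [L.curv_eq, L.curv_eq, L.curv_eq, map_add, rotBracket_add_left G
    ((L.form.smooth p hp v).2.loopSmooth u) ((L.form.smooth p hp v').2.loopSmooth u),
    extD_add_left (L.contDiff_lamL p hp), h1, ← Prod.mk_add_mk]
  abel

theorem Connection.curv_smul_left (r : ℝ) (u v w : Euc n) : L.curv p hp u (r • v) w
    = r • L.curv p hp u v w := by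
  have h1 : ((fun θ => extD (fun u v => L.LamL p hp θ u v) u (r • v) w) : UnitAddCircle → E)
      = r • fun θ => extD (fun u v => L.LamL p hp θ u v) u v w :=
    funext fun θ => extD_smul_left (L.contDiff_LamL p hp θ) r u v w
  rw [L.curv_eq, L.curv_eq, map_smul, rotBracket_smul_left,
    extD_smul_left (L.contDiff_lamL p hp), h1, smul_add]
  rfl

theorem Connection.smooth_curv (v w : Euc n) :
    SmoothRot E (fun u => L.curv p hp u v w) := by
  obtain ⟨a1, a2⟩ := L.form.smooth p hp v
  obtain ⟨b1, b2⟩ := L.form.smooth p hp w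
  have := FiniteDimensional.complete ℝ E
  refine ⟨(contDiff_extD (L.contDiff_lamL p hp) v w).add contDiff_const, ?_⟩
  have h1 : SmoothLoop (fun u θ => extD (fun u v => L.LamL p hp θ u v) u v w) :=
    (b2.dLoop v).sub (a2.dLoop w)
  exact h1.add (((a2.bilin (gBracketL G) b2).add (b2.loopDeriv.smul a1)).sub
    (a2.loopDeriv.smul b1))

theorem Connection.curv_natural {m : ℕ} {f : Euc m → Euc n} (hf : ContDiff ℝ ∞ f)
    (u v w : Euc m) : L.curv (p ∘ f) (isPlot_reparam hp hf) u v w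
      = L.curv p hp (f u) (fderiv ℝ f u v) (fderiv ℝ f u w) := by
  have h : (fun u v => L.form.val (p ∘ f) (isPlot_reparam hp hf) u v)
      = fun u v => L.form.val p hp (f u) (fderiv ℝ f u v) :=
    funext fun u => funext fun v => L.form.natural p hp f hf u v
  unfold Connection.curv
  rw [h]
  refine congrArg₂ (· + ·) (Prod.ext ?_ (funext fun θ => ?_)) rfl
  · exact extD_pullback (L.contDiff_lamL p hp) hf u v w
  · exact extD_pullback (L.contDiff_LamL p hp θ) hf u v w

/-- The linear map `σ` commutes with `d`, so the two curvatures differ only by its failure to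
preserve brackets, which is the cocycle. -/
theorem Connection.affCurv_sigma (ip : LinearMap.BilinForm ℝ E) (k : ℤ) (u v w : Euc n) :
    affCurv G ip k (fun u v => sigma (L.form.val p hp u v)) u v w
      = sigma (L.curv p hp u v w)
        + omegaSigma G ip k (L.form.val p hp u v) (L.form.val p hp u w) := by
  refine Prod.ext ?_ (Prod.ext ?_ ?_)
  · simp [affCurv, sigma, Connection.curv, rotCurv, omegaSigma, affBracket, rotBracket]
  · simp only [affCurv, sigma, Connection.curv, rotCurv, omegaSigma, Prod.snd_add, Prod.fst_add,
      Prod.snd_sub, Prod.fst_sub]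
    simp [affBracket, rotBracket]
  · simp [affCurv, sigma, omegaSigma, affBracket, extD]

theorem omegaSigma_eq_centre (ip : LinearMap.BilinForm ℝ E) (k : ℤ) (X Y : RotAlg E) :
    omegaSigma G ip k X Y = centre (k * loopPair ip X.2 (loopDeriv Y.2)) := by
  refine Prod.ext ?_ (Prod.ext ?_ ?_)
  · simp [omegaSigma, affBracket, rotBracket, sigma, centre]
  · simp [omegaSigma, affBracket, rotBracket, sigma, centre]
  · simp [omegaSigma, affBracket, sigma, centre]

end Curvature

/-! ### The Higgs splitting and the module curvature -/

section ModuleCurvature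

variable {E : Type*} [NormedAddCommGroup E] [NormedSpace ℝ E] [FiniteDimensional ℝ E]
  {G : Type*} [TopologicalSpace G] [ChartedSpace E G] [Group G]
  [LieGroup 𝓘(ℝ, E) ∞ G] {n : ℕ} {Q : Type*} [DiffeologicalSpace Q]
  [MulAction (LoopRot E G)ᵐᵒᵖ Q] (ip : LinearMap.BilinForm ℝ E) (k : ℤ)

theorem HiggsField.loopSmooth (V : HiggsField E G Q) (q : Q) : LoopSmooth (V.Φ q) :=
  -- A single point is a plot with zero-dimensional parameter space.
  (V.smooth (n := 0) (fun _ => q) isPlot_const).loopSmooth 0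

/-- The map `(1 - s) σ` defined by the Higgs field. -/
def HiggsField.horizontal (V : HiggsField E G Q) (q : Q) (X : RotAlg E) : AffAlg E :=
  sigma X - V.split ip k q (sigma X)

theorem HiggsField.horizontal_eq (V : HiggsField E G Q) (q : Q) (X : RotAlg E) :
    V.horizontal ip k q X = (X.1, X.2, -(k * loopPair ip X.2 (V.Φ q))
      - (k / 2 : ℝ) * X.1 * loopPair ip (V.Φ q) (V.Φ q)) := by
  have h : loopPair ip X.2 (-V.Φ q) = -loopPair ip X.2 (V.Φ q) := by
    unfold loopPair
    rw [← integral_neg]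
    simp
  refine Prod.ext ?_ (Prod.ext ?_ ?_)
  · simp [horizontal, sigma, split, centre]
  · simp [horizontal, sigma, split, centre]
  · simp only [horizontal, sigma, split, centre, affPair, HiggsField.lift, Prod.snd_sub, h]
    ring

theorem HiggsField.horizontal_add (V : HiggsField E G Q) (q : Q) {X Y : RotAlg E}
    (hX : LoopSmooth X.2) (hY : LoopSmooth Y.2) :
    V.horizontal ip k q (X + Y) = V.horizontal ip k q X + V.horizontal ip k q Y := by
  simp only [horizontal_eq, Prod.fst_add, Prod.snd_add,
    loopPair_add_left ip hX hY (V.loopSmooth q)]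
  refine Prod.ext rfl (Prod.ext rfl ?_)
  simp only [Prod.snd_add]
  ring

theorem HiggsField.horizontal_smul (V : HiggsField E G Q) (q : Q) (r : ℝ) (X : RotAlg E) :
    V.horizontal ip k q (r • X) = r • V.horizontal ip k q X := by
  simp only [horizontal_eq, Prod.smul_fst, Prod.smul_snd, loopPair_smul_left]
  refine Prod.ext rfl (Prod.ext rfl ?_)
  simp only [Prod.smul_snd, smul_eq_mul]
  ring

theorem HiggsField.horizontal_neg (V : HiggsField E G Q) (q : Q) (X : RotAlg E) :
    V.horizontal ip k q (-X) = -V.horizontal ip k q X := by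
  rw [← neg_one_smul ℝ X, horizontal_smul, neg_one_smul]

/-- The 2-form `(1 - s) σ(F_L)`. -/
def moduleCurvature (L : Connection E G Q) (V : HiggsField E G Q) :
    TwoForm Q (AffAlg E) (SmoothAff E) where
  val p hp u := LinearMap.mk₂ ℝ (fun v w => V.horizontal ip k (p u) (L.curv p hp u v w))
    (fun v v' w => by
      rw [L.curv_add_left, V.horizontal_add ip k _ ((L.smooth_curv p hp v w).2.loopSmooth u)
        ((L.smooth_curv p hp v' w).2.loopSmooth u)])
    (fun r v w => by rw [L.curv_smul_left, V.horizontal_smul])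
    (fun v w w' => by
      rw [L.curv_skew, L.curv_skew p hp u v w, L.curv_skew p hp u v w', L.curv_add_left, neg_add,
        V.horizontal_add ip k _ ((L.smooth_curv p hp w v).2.loopSmooth u).neg
          ((L.smooth_curv p hp w' v).2.loopSmooth u).neg])
    (fun r v w => by
      rw [L.curv_skew, L.curv_skew p hp u v w, L.curv_smul_left, V.horizontal_neg,
        V.horizontal_neg, V.horizontal_smul, smul_neg])
  alternating p hp u v := by
    rw [LinearMap.mk₂_apply, L.curv_self, ← zero_smul ℝ (0 : RotAlg E), V.horizontal_smul, zero_smul]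
  smooth p hp v w := by
    obtain ⟨h1, h2⟩ := L.smooth_curv p hp v w
    have hV := V.smooth p hp
    simp only [LinearMap.mk₂_apply, HiggsField.horizontal_eq]
    exact ⟨h1, h2, (contDiff_const.mul (h2.contDiff_loopPair ip hV)).neg.sub
      ((contDiff_const.mul h1).mul (hV.contDiff_loopPair ip hV))⟩
  natural p hp f hf u v w := by
    simp only [LinearMap.mk₂_apply, L.curv_natural p hp hf]
    rfl

variable {ip k} {K : Type*} [Group K] [DiffeologicalSpace K]

/-- `Ṽ` is the lift of `V` that is null for the invariant pairing, and this fixes its central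
component. The check is the expansion of `(k/2)⟪Φ - l, Φ - l⟫`, with `Φ` twisted and `l = γ⁻¹γ'`. -/
theorem HiggsField.lift_ract (ip_symm : ∀ x y, ip x y = ip y x)
    (ip_inv : ∀ (g : G) (x y : E), ip (gAd g x) (gAd g y) = ip x y) (V : HiggsField E G Q)
    (q : Q) (g : LoopRot E G) :
    V.lift ip k (ract q g) = affAd ip k g⁻¹ (V.lift ip k q) := by
  have h := V.equivariant q g
  have hl := loopSmooth_loopLog g
  have ht := (V.loopSmooth q).twist g
  rw [rotAd_inv] at h
  have h2 : V.Φ (ract q g) = fun θ => (twist g (V.Φ q) - loopLog g) (θ + -g.angle) := by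
    have h3 := congrArg (fun X : RotAlg E => -X.2) h
    simp only [neg_neg] at h3
    rw [h3]
    ext θ
    simp [twist_neg]
    abel
  rw [affAd_inv ip_inv]
  refine Prod.ext rfl (Prod.ext ?_ ?_)
  · exact congrArg (fun X : RotAlg E => X.2) h
  · simp only [HiggsField.lift, shiftAff, twistAff, h2, loopPair_shift]
    rw [loopPair_sub_left ht hl (ht.sub hl), loopPair_sub_right ip_symm ht ht hl,
      loopPair_sub_right ip_symm hl ht hl, twist_neg, loopPair_neg_right ip_symm,
      loopPair_twist ip_inv, loopPair_symm ip_symm (twist g (V.Φ q))]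
    ring

theorem HiggsField.split_affAd (ip_symm : ∀ x y, ip x y = ip y x)
    (ip_inv : ∀ (g : G) (x y : E), ip (gAd g x) (gAd g y) = ip x y) (V : HiggsField E G Q)
    (q : Q) (g : LoopRot E G) {X : AffAlg E} (hX : LoopSmooth X.2.1) :
    V.split ip k (ract q g) (affAd ip k g⁻¹ X) = V.split ip k q X := by
  unfold HiggsField.split
  rw [V.lift_ract ip_symm ip_inv, affPair_affAd ip_symm ip_inv g hX]
  exact (V.loopSmooth q).neg

/-- Since `s` is the identity on the centre, `1 - s` factors through the quotient. This is what lets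
the curvature on `J` descend to `Q`. -/
theorem HiggsField.horizontal_proj (V : HiggsField E G Q) (q : Q) (X : AffAlg E) :
    V.horizontal ip k q (proj X) = X - V.split ip k q X := by
  refine Prod.ext ?_ (Prod.ext ?_ ?_)
  · simp [horizontal, sigma, split, centre, proj]
  · simp [horizontal, sigma, split, centre, proj]
  · simp only [horizontal, sigma, split, centre, proj, affPair, HiggsField.lift, Prod.snd_sub]
    ring

theorem isPrincipalCurvature_moduleCurvature (ip_symm : ∀ x y, ip x y = ip y x)
    (ip_inv : ∀ (g : G) (x y : E), ip (gAd g x) (gAd g y) = ip x y)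
    (ext : LevelExtension E G ip k K) {B : Type*} [DiffeologicalSpace B]
    {π : Q → B} (hπ : IsPrincipalBundle E G π) (L : Connection E G Q) (V : HiggsField E G Q) :
    IsPrincipalCurvature ext L V (moduleCurvature ip k L V) := by
  intro n p hp h hh hph u v w
  have hg := ext.smooth_q h hh
  have hA : ∀ v, SmoothAff E (fun u => sigma (L.form.val p hp u v)) := fun v =>
    ⟨(L.form.smooth p hp v).1, (L.form.smooth p hp v).2, contDiff_const⟩
  have hcurv : affCurv G ip k (principalConnection ext L p hp h hh) u v w
      = affAd ip k (ext.q (h u))⁻¹ (sigma (L.curv p hp u v w))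
        + omegaSigma G ip k (L.form.val p hp u v) (L.form.val p hp u w) := by
    refine (ext.affCurv_gauge ip_symm ip_inv h hh hA u v w).trans ?_
    rw [L.affCurv_sigma, omegaSigma_eq_centre, affAd_add_centre]
  -- Modulo the centre, the connection on `J` is the pullback of `L` along the second projection.
  have hform : (fun u v => L.form.val (fun u => ract (p u) (ext.q (h u))) hph u v)
      = fun u v => proj (principalConnection ext L p hp h hh u v) := by
    ext1 u
    ext1 v
    rw [L.form_ract hπ p hp hg hph]
    simp [principalConnection, LevelExtension.mc, proj, sigma, centre, affAd]
    rfl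
  -- Projection intertwines the affine and the rotation brackets, hence the curvatures, and it
  -- discards the cocycle term.
  have hF : L.curv (fun u => ract (p u) (ext.q (h u))) hph u v w
      = proj (affAd ip k (ext.q (h u))⁻¹ (sigma (L.curv p hp u v w))) := by
    have h1 : L.curv (fun u => ract (p u) (ext.q (h u))) hph u v w
        = proj (affCurv G ip k (principalConnection ext L p hp h hh) u v w) := by
      unfold Connection.curv
      rw [hform]
      rfl
    rw [h1, hcurv, omegaSigma_eq_centre]
    simp [proj, centre]
  have hval : (moduleCurvature ip k L V).val (fun u => ract (p u) (ext.q (h u))) hph u v w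
      = V.horizontal ip k (ract (p u) (ext.q (h u)))
        (L.curv (fun u => ract (p u) (ext.q (h u))) hph u v w) := rfl
  rw [hval, hF, V.horizontal_proj, V.split_affAd ip_symm ip_inv, hcurv, curving]
  · abel
  · exact (L.smooth_curv p hp v w).2.loopSmooth u

/-- A module curvature is determined by its values on the plots of `Q × {1}`. -/
theorem IsPrincipalCurvature.unique {ext : LevelExtension E G ip k K} {L : Connection E G Q}
    {V : HiggsField E G Q} {𝓕 𝓕' : TwoForm Q (AffAlg E) (SmoothAff E)}
    (h𝓕 : IsPrincipalCurvature ext L V 𝓕) (h𝓕' : IsPrincipalCurvature ext L V 𝓕') : 𝓕 = 𝓕' := by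
  have key : ∀ {n : ℕ} (p : Euc n → Q) (hp : IsPlot p) (u v w : Euc n),
      𝓕.val p hp u v w = 𝓕'.val p hp u v w := by
    intro n p hp u v w
    have h1 : (fun u => ract (p u) (ext.q ((fun _ : Euc n => (1 : K)) u))) = p := by
      ext u
      simp [ract]
    have hp1 : IsPlot (fun u => ract (p u) (ext.q ((fun _ : Euc n => (1 : K)) u))) := by
      rw [h1]
      exact hp
    have h2 := (h𝓕 p hp (fun _ => 1) isPlot_const hp1 u v w).trans
      (h𝓕' p hp (fun _ => 1) isPlot_const hp1 u v w).symm
    -- The plot `p·q(1)` equals `p` only propositionally and `val` depends on the proof of plothood,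
    -- so the equality is transported by generalising the plot.
    have h3 : ∀ (p' : Euc n → Q) (hp' : IsPlot p'), p' = p →
        𝓕.val p' hp' u v w = 𝓕'.val p' hp' u v w → 𝓕.val p hp u v w = 𝓕'.val p hp u v w := by
      rintro _ _ rfl h
      exact h
    exact h3 _ hp1 h1 h2
  refine TwoForm.ext ?_
  funext n p hp u
  exact LinearMap.ext fun v => LinearMap.ext fun w => key p hp u v w

end ModuleCurvature

end LoopLift

end
-- The theorem
open LoopLift in
theorem mainTheorem11 {E : Type*} [NormedAddCommGroup E] [NormedSpace ℝ E]
    [FiniteDimensional ℝ E] {G : Type*} [TopologicalSpace G] [ChartedSpace E G] [Group G]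
    [LieGroup 𝓘(ℝ, E) ∞ G]
    (ip : LinearMap.BilinForm ℝ E) (ip_symm : ∀ x y, ip x y = ip y x)
    (ip_inv : ∀ (g : G) (x y : E), ip (gAd g x) (gAd g y) = ip x y) (k : ℤ)
    {K : Type*} [Group K] [DiffeologicalSpace K] (ext : LevelExtension E G ip k K)
    {Q B : Type*} [DiffeologicalSpace Q] [DiffeologicalSpace B]
    [MulAction (LoopRot E G)ᵐᵒᵖ Q] (π : Q → B) (hπ : IsPrincipalBundle E G π)
    (L : Connection E G Q) (V : HiggsField E G Q) :
    ∃ 𝓕 : TwoForm Q (AffAlg E) (SmoothAff E),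
      IsPrincipalCurvature ext L V 𝓕 ∧
      (∀ 𝓕' : TwoForm Q (AffAlg E) (SmoothAff E), IsPrincipalCurvature ext L V 𝓕' → 𝓕' = 𝓕) ∧
      ∀ {n : ℕ} (p : Euc n → Q) (hp : IsPlot p) (u v w : Euc n),
        𝓕.val p hp u v w = sigma (L.curv p hp u v w)
          - V.split ip k (p u) (sigma (L.curv p hp u v w)) ∧
        𝓕.val p hp u v w =
          (L.dlam p hp u v w, L.curvLoop p hp u v w,
            -(k * loopPair ip (L.curvLoop p hp u v w) (V.Φ (p u)))
              - (k / 2 : ℝ) * L.dlam p hp u v w * loopPair ip (V.Φ (p u)) (V.Φ (p u))) := by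

  refine ⟨moduleCurvature ip k L V, isPrincipalCurvature_moduleCurvature ip_symm ip_inv ext hπ L V,
    fun 𝓕' h𝓕' => h𝓕'.unique (isPrincipalCurvature_moduleCurvature ip_symm ip_inv ext hπ L V),
    fun p hp u v w => ⟨rfl, ?_⟩⟩
  refine (V.horizontal_eq ip k (p u) (L.curv p hp u v w)).trans ?_
  -- The bracket of `ℝ ⊕ L𝔤` has zero circle component.
  have h : (L.curv p hp u v w).1 = L.dlam p hp u v w := add_zero _
  rw [h]
  rfl
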